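/- All graphs are finite and simple. A graph on $N$ vertices is non-Hamiltonian if it contains no simple cycle of length $N$. A graph is called $e$-edge-connected here if its edge-connectivity is exactly $e$, that is, deleting fewer than $e$ edges never disconnects it, but deleting some $e$ edges does (so a $1$-edge-connected graph is a connected graph with a bridge). A $(k,g)$-cage is a $k$-regular graph of girth $g$ with the minimum possible number of vertices, and $n(k,g)$ denotes this number. A $(k,g,e)$-prison is a non-Hamiltonian, $e$-edge-connected, $k$-regular graph of girth $g$ with the minimum possible number of vertices, and $\bar n(k,g,e)$ denotes this number. Theorem. Let $g\ge 3$. For each $e\in\{1,2,3\}$ there exists a non-Hamiltonian, $e$-edge-connected, $3$-regular graph of girth $g$. Moreover, $(3,g)$-cages exist, $(3,g,e)$-prisons exist for each $e\in\{1,2,3\}$, and $$\bar n(3,g,1)\le 2\,n(3,g)+2,\qquad \bar n(3,g,2)\le 3\,n(3,g)+2,\qquad \bar n(3,g,3)\le 10\,n(3,g)-10 .$$ -/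

import Mathlib

/-- `G` is a `k`-regular finite simple graph of girth exactly `g`. (The girth is taken in `ℕ∞`, so
an acyclic graph, whose girth is `⊤`, never qualifies.) -/
def IsRegularWithGirth (k g : ℕ) {V : Type*} [Fintype V] (G : SimpleGraph V) : Prop :=
  (open Classical in G.IsRegularOfDegree k) ∧ G.egirth = (g : ℕ∞)

/-- The edge-connectivity of `G` is exactly `e`: fewer than `e` edge deletions never disconnect
`G`, but some set of at most `e` edges does. In particular, edge-connectivity `1` means that `G` is
connected and has a bridge. -/
def HasEdgeConnectivity (e : ℕ) {V : Type*} (G : SimpleGraph V) : Prop :=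
  G.IsEdgeConnected e ∧ ¬ G.IsEdgeConnected (e + 1)

/-- `G` is a non-Hamiltonian `k`-regular graph of girth `g` and edge-connectivity `e`. -/
def IsPrisonCandidate (k g e : ℕ) {V : Type*} [Fintype V] [DecidableEq V]
    (G : SimpleGraph V) : Prop :=
  IsRegularWithGirth k g G ∧ HasEdgeConnectivity e G ∧ ¬ G.IsHamiltonian

/-- A `(k, g)`-cage: a `k`-regular graph of girth `g` with the minimum possible number of
vertices. Finite graphs are taken on the vertex sets `Fin n`. -/
def IsCage (k g : ℕ) {n : ℕ} (G : SimpleGraph (Fin n)) : Prop :=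
  IsRegularWithGirth k g G ∧
    ∀ (m : ℕ) (H : SimpleGraph (Fin m)), IsRegularWithGirth k g H → n ≤ m

/-- A `(k, g, e)`-prison: a non-Hamiltonian `k`-regular graph of girth `g` and edge-connectivity
`e` with the minimum possible number of vertices. -/
def IsPrison (k g e : ℕ) {n : ℕ} (G : SimpleGraph (Fin n)) : Prop :=
  IsPrisonCandidate k g e G ∧
    ∀ (m : ℕ) (H : SimpleGraph (Fin m)), IsPrisonCandidate k g e H → n ≤ m

/-- `n(k, g)`, the number of vertices of a `(k, g)`-cage. -/
noncomputable def cageOrder (k g : ℕ) : ℕ :=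
  sInf {n : ℕ | ∃ G : SimpleGraph (Fin n), IsCage k g G}

/-- `n̄(k, g, e)`, the number of vertices of a `(k, g, e)`-prison. -/
noncomputable def prisonOrder (k g e : ℕ) : ℕ :=
  sInf {n : ℕ | ∃ G : SimpleGraph (Fin n), IsPrison k g e G}

open SimpleGraph

/-! All three constructions start from a cubic graph `C` of girth at least `g` with as few vertices
as possible. Such graphs exist because three involutions acting on a ball of the 3-regular tree
generate a Cayley graph of large girth. Minimality has two consequences. The girth of `C` is exactly
`g`, so `C` is a cage: otherwise deleting two adjacent vertices and rejoining their neighbours gives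
a smaller graph (`exists_isCubic_card_lt`). Also, `C` is 3-edge-connected
(`IsMinimalCubic.three_le_ncard_cut`): given a cut of at most two edges, the smaller side loses one
or two ends of cut edges, and two copies of the rest are glued into a smaller cubic graph of girth
at least `g`. Moreover, a shortest cycle has no chord, so it misses some vertex `z`.

The three graphs are: two copies of `C` with an edge at `z` subdivided, joined by a bridge; three
copies of `C` minus an edge at `z`, hung between two hubs; the Petersen graph with every vertex
replaced by `C - z`. A `g`-cycle of `C - z` survives in each. A Hamiltonian cycle meets every edge
cut in a positive even number of edges. This is impossible at a bridge, forces three cycle edges at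
a hub, and in the last case contracts to a connected 2-factor of the Petersen graph.

Girth is bounded below by potentials instead of by tracing cycles (`le_egirth_of_separating`): if an
integer function changes by at most one along every edge except `e`, and by at least `g - 1` along
`e`, then a cycle through `e` has length at least `g`. Each surgery supplies such functions, mostly
truncated distances. -/

/-- Every vertex has exactly three neighbours. -/
def IsCubic {V : Type*} (G : SimpleGraph V) : Prop := ∀ v, (G.neighborSet v).ncard = 3

theorem isRegularOfDegree_three_iff {V : Type*} [Fintype V] (G : SimpleGraph V) :
    (open Classical in G.IsRegularOfDegree 3) ↔ IsCubic G := by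
  classical
  refine forall_congr' fun v ↦ ?_
  rw [Set.ncard_eq_toFinset_card', ← SimpleGraph.card_neighborFinset_eq_degree,
    SimpleGraph.neighborFinset]

/-! ### Girth bounds from integer potentials -/

section Girth

variable {V : Type*} {G : SimpleGraph V}

theorem abs_sub_le_length_of_notMem_edges {f : V → ℤ} {s t : V}
    (hf : ∀ x y, G.Adj x y → s(x, y) ≠ s(s, t) → f y ≤ f x + 1) {u v : V} (p : G.Walk u v)
    (hp : s(s, t) ∉ p.edges) : f v ≤ f u + p.length ∧ f u ≤ f v + p.length := by
  induction p with
  | nil => simp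
  | cons h p ih =>
    simp only [SimpleGraph.Walk.edges_cons, List.mem_cons, not_or] at hp
    have h1 := hf _ _ h (Ne.symm hp.1)
    have h2 := hf _ _ h.symm (by rw [Sym2.eq_swap]; exact Ne.symm hp.1)
    have := ih hp.2
    simp only [SimpleGraph.Walk.length_cons]
    push_cast
    omega

/-- A trail crosses `st` exactly once, in one of two directions, so its other `p.length - 1` steps
account for the rest of the change in `f`. For a closed trail both alternatives give `|f t - f s| +
1 ≤ p.length`. -/
theorem abs_sub_le_length_of_mem_edges {f : V → ℤ} {s t : V}
    (hf : ∀ x y, G.Adj x y → s(x, y) ≠ s(s, t) → f y ≤ f x + 1) {u v : V} (p : G.Walk u v)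
    (hp : p.IsTrail) (hmem : s(s, t) ∈ p.edges) :
    ((f v - f u - (f t - f s) + 1 ≤ p.length) ∧ (f u - f v - (f s - f t) + 1 ≤ p.length)) ∨
    ((f v - f u - (f s - f t) + 1 ≤ p.length) ∧ (f u - f v - (f t - f s) + 1 ≤ p.length)) := by
  induction p with
  | nil => simp at hmem
  | @cons a b c h p ih =>
    rw [SimpleGraph.Walk.isTrail_cons] at hp
    simp only [SimpleGraph.Walk.length_cons]
    push_cast
    by_cases he : s(s, t) = s(a, b)
    · have := abs_sub_le_length_of_notMem_edges hf p (by rw [he]; exact hp.2)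
      rw [Sym2.eq_iff] at he
      rcases he with ⟨rfl, rfl⟩ | ⟨rfl, rfl⟩
      · left; omega
      · right; omega
    · have h1 := hf _ _ h (Ne.symm he)
      have h2 := hf _ _ h.symm (by rw [Sym2.eq_swap]; exact Ne.symm he)
      have := ih hp.1 (by simpa [he] using hmem)
      omega

/-- A lower bound on the girth: every edge outside a subgraph of large girth is certified by an
integer function that varies by at most one along all other edges. -/
theorem le_egirth_of_separating {G H : SimpleGraph V} {g : ℕ} (hH : (g : ℕ∞) ≤ H.egirth)
    (h : ∀ s t, G.Adj s t → ¬ H.Adj s t → ∃ f : V → ℤ,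
      (∀ x y, G.Adj x y → s(x, y) ≠ s(s, t) → f y ≤ f x + 1) ∧
      (f s + g ≤ f t + 1 ∨ f t + g ≤ f s + 1)) : (g : ℕ∞) ≤ G.egirth := by
  rw [SimpleGraph.le_egirth] at hH ⊢
  intro a w hw
  by_cases hall : ∀ e ∈ w.edges, e ∈ H.edgeSet
  · simpa using hH a (w.transfer H hall) (hw.transfer hall)
  · push Not at hall
    obtain ⟨e, he, hne⟩ := hall
    induction e using Sym2.ind with
    | _ s t =>
      have hst : G.Adj s t := w.edges_subset_edgeSet he
      obtain ⟨f, hf, hfst⟩ := h s t hst hne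
      have := abs_sub_le_length_of_mem_edges hf w hw.isTrail he
      have : g ≤ w.length := by omega
      exact_mod_cast this

/-- The distance from `x`, truncated at `c`. -/
theorem exists_truncated_dist (G : SimpleGraph V) (x : V) (c : ℕ) : ∃ f : V → ℤ, f x = 0 ∧
    (∀ y, 0 ≤ f y) ∧ (∀ y, f y ≤ c) ∧ (∀ y z, G.Adj y z → f z ≤ f y + 1) ∧
    ∀ y (m : ℕ), m ≤ c → (∀ p : G.Walk x y, m ≤ p.length) → (m : ℤ) ≤ f y := by
  -- Truncation makes the extended distance finite, so `toNat` loses nothing; unreachable vertices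
  -- get the value `c`.
  have key : ∀ y, ((min (G.edist x y) c).toNat : ℕ∞) = min (G.edist x y) c := fun y ↦
    ENat.natCast_toNat (ne_top_of_le_ne_top (ENat.natCast_ne_top c) (min_le_right _ _))
  refine ⟨fun y ↦ ((min (G.edist x y) c).toNat : ℤ), by simp, by simp, fun y ↦ ?_,
    fun y z hyz ↦ ?_, fun y m hm hp ↦ ?_⟩
  · have : ((min (G.edist x y) c).toNat : ℕ∞) ≤ c := (key y).le.trans (min_le_right _ _)
    beta_reduce; exact_mod_cast this
  · have : ((min (G.edist x z) c).toNat : ℕ∞) ≤ (min (G.edist x y) c).toNat + 1 := by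
      rw [key, key]
      have h1 : G.edist x z ≤ G.edist x y + 1 :=
        (SimpleGraph.edist_triangle (v := y)).trans
          (by rw [SimpleGraph.edist_eq_one_iff_adj.2 hyz])
      rcases le_total (G.edist x y) c with h | h
      · rw [min_eq_left h]; exact (min_le_left _ _).trans h1
      · rw [min_eq_right h]; exact (min_le_right _ _).trans le_self_add
    beta_reduce; exact_mod_cast this
  · have : (m : ℕ∞) ≤ (min (G.edist x y) c).toNat := by
      rw [key]
      refine le_min ?_ (by exact_mod_cast hm)
      by_cases hr : G.Reachable x y
      · obtain ⟨p, hp'⟩ := hr.exists_walk_length_eq_edist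
        rw [← hp']; exact_mod_cast hp p
      · rw [SimpleGraph.edist_eq_top_of_not_reachable hr]; exact le_top
    beta_reduce; exact_mod_cast this

/-- The ends of an edge are at distance at least `g - 1` once the edge is removed. -/
theorem le_length_add_one_of_notMem_edges {g : ℕ} (hg : (g : ℕ∞) ≤ G.egirth) {u v : V}
    (huv : G.Adj u v) (p : G.Walk u v) (hp : s(u, v) ∉ p.edges) : g ≤ p.length + 1 := by
  classical
  have hc : (SimpleGraph.Walk.cons huv.symm p.bypass).IsCycle := by
    rw [SimpleGraph.Walk.cons_isCycle_iff]
    refine ⟨p.bypass_isPath, fun h ↦ hp ?_⟩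
    rw [Sym2.eq_swap]
    exact p.edges_bypass_subset_edges h
  have h1 := (SimpleGraph.le_egirth.1 hg) _ _ hc
  have h2 := p.length_bypass_le_length
  have h3 : g ≤ p.bypass.length + 1 := by
    rw [SimpleGraph.Walk.length_cons] at h1; exact_mod_cast h1
  omega

/-- Two neighbours of a vertex are at distance at least `g - 2` once the vertex is removed. -/
theorem le_length_add_two_of_notMem_support {g : ℕ} (hg : (g : ℕ∞) ≤ G.egirth) {a p q : V}
    (hp : G.Adj a p) (hq : G.Adj a q) (hpq : p ≠ q) (w : G.Walk p q) (hw : a ∉ w.support) :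
    g ≤ w.length + 2 := by
  have := le_length_add_one_of_notMem_edges hg hp.symm (w.append (.cons hq.symm .nil)) ?_
  · simpa using this
  · rw [SimpleGraph.Walk.edges_append]
    simp only [SimpleGraph.Walk.edges_cons, SimpleGraph.Walk.edges_nil, List.mem_append,
      List.mem_singleton, not_or]
    refine ⟨fun h ↦ hw (SimpleGraph.Walk.snd_mem_support_of_mem_edges _ h), fun h ↦ hpq ?_⟩
    have := hq.ne
    simp_all

end Girth

/-! ### Edge cuts, edge-connectivity and 2-factors -/

/-- The adjacent pairs from `A` to `B`. -/
def adjPairs {V : Type*} (G : SimpleGraph V) (A B : Set V) : Set (V × V) :=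
  {p | p.1 ∈ A ∧ p.2 ∈ B ∧ G.Adj p.1 p.2}

section Cuts

variable {V : Type*} {G : SimpleGraph V}

theorem mem_adjPairs {A B : Set V} {x y : V} :
    (x, y) ∈ adjPairs G A B ↔ x ∈ A ∧ y ∈ B ∧ G.Adj x y := Iff.rfl

theorem ncard_adjPairs_comm (A B : Set V) :
    (adjPairs G A B).ncard = (adjPairs G B A).ncard := by
  refine Set.ncard_congr (fun p _ ↦ p.swap) ?_ ?_ ?_
  · rintro ⟨x, y⟩ ⟨h1, h2, h3⟩
    exact ⟨h2, h1, h3.symm⟩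
  · rintro ⟨x, y⟩ ⟨x', y'⟩ _ _ h
    simpa [and_comm] using h
  · rintro ⟨x, y⟩ ⟨h1, h2, h3⟩
    exact ⟨(y, x), ⟨h2, h1, h3.symm⟩, rfl⟩

theorem ncard_adjPairs_union_right [Finite V] {A B C : Set V} (h : Disjoint B C) :
    (adjPairs G A (B ∪ C)).ncard = (adjPairs G A B).ncard + (adjPairs G A C).ncard := by
  rw [← Set.ncard_union_eq ?_ (Set.toFinite _) (Set.toFinite _)]
  · congr 1
    ext ⟨x, y⟩
    simp only [adjPairs, Set.mem_ofPred_eq, Set.mem_union]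
    tauto
  · rw [Set.disjoint_left] at h ⊢
    rintro ⟨x, y⟩ h1 h2
    exact h h1.2.1 h2.2.1

theorem ncard_adjPairs_singleton_univ (v : V) :
    (adjPairs G {v} Set.univ).ncard = (G.neighborSet v).ncard := by
  refine Set.ncard_congr (fun p _ ↦ p.2) ?_ ?_ ?_
  · rintro ⟨x, y⟩ ⟨rfl, h2, h3⟩
    exact h3
  · rintro ⟨x, y⟩ ⟨x', y'⟩ ⟨rfl, _⟩ ⟨rfl, _⟩ h
    simpa using h
  · intro y hy
    exact ⟨(v, y), ⟨rfl, trivial, hy⟩, rfl⟩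

theorem ncard_adjPairs_singleton_compl (v : V) :
    (adjPairs G {v} {v}ᶜ).ncard = (G.neighborSet v).ncard := by
  rw [← ncard_adjPairs_singleton_univ]
  congr 1
  ext ⟨x, y⟩
  simp only [mem_adjPairs, Set.mem_singleton_iff, Set.mem_compl_iff, Set.mem_univ, true_and]
  exact ⟨fun h ↦ ⟨h.1, h.2.2⟩, fun h ↦ ⟨h.1, fun h' ↦ h.2.ne (h.1.trans h'.symm), h.2⟩⟩

/-- Edge-connectivity in terms of cuts. -/
theorem isEdgeConnected_iff_le_ncard_cut [Finite V] {k : ℕ} :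
    G.IsEdgeConnected k ↔
      ∀ S : Set V, S.Nonempty → Sᶜ.Nonempty → k ≤ (adjPairs G S Sᶜ).ncard := by
  constructor
  · rintro h S ⟨a, ha⟩ ⟨b, hb⟩
    by_contra! hlt
    have hs : ((fun p : V × V ↦ s(p.1, p.2)) '' adjPairs G S Sᶜ).encard < k := by
      refine (Set.encard_image_le _ _).trans_lt ?_
      rw [← (Set.toFinite (adjPairs G S Sᶜ)).cast_ncard_eq]
      exact_mod_cast hlt
    obtain ⟨p⟩ := h a b hs
    apply hb
    clear hb
    induction p with
    | nil => exact ha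
    | @cons x y z hxy p ih =>
      refine ih ?_
      by_contra hy
      rw [deleteEdges_adj] at hxy
      exact hxy.2 ⟨(x, y), ⟨ha, hy, hxy.1⟩, rfl⟩
  · intro h u v s hs
    by_contra hr
    let S : Set V := {x | (G.deleteEdges s).Reachable u x}
    have hk := h S ⟨u, Reachable.refl u⟩ ⟨v, hr⟩
    have hsub : (fun p : V × V ↦ s(p.1, p.2)) '' adjPairs G S Sᶜ ⊆ s := by
      rintro _ ⟨⟨x, y⟩, ⟨hx, hy, hxy⟩, rfl⟩
      by_contra hns
      exact hy (Reachable.trans hx (Adj.reachable (deleteEdges_adj.2 ⟨hxy, hns⟩)))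
    have hinj : Set.InjOn (fun p : V × V ↦ s(p.1, p.2)) (adjPairs G S Sᶜ) := by
      rintro ⟨x, y⟩ ⟨hx, hy, -⟩ ⟨x', y'⟩ ⟨hx', hy', -⟩ he
      rcases Sym2.eq_iff.1 he with ⟨rfl, rfl⟩ | ⟨rfl, rfl⟩
      · rfl
      · exact absurd hx hy'
    have h1 := Set.encard_le_encard hsub
    rw [hinj.encard_image, ← (Set.toFinite (adjPairs G S Sᶜ)).cast_ncard_eq] at h1
    exact absurd (h1.trans_lt hs) (by exact_mod_cast hk.not_gt)

theorem hasEdgeConnectivity_iff [Finite V] {e : ℕ} :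
    HasEdgeConnectivity e G ↔
      (∀ S : Set V, S.Nonempty → Sᶜ.Nonempty → e ≤ (adjPairs G S Sᶜ).ncard) ∧
      ∃ S : Set V, S.Nonempty ∧ Sᶜ.Nonempty ∧ (adjPairs G S Sᶜ).ncard ≤ e := by
  simp only [HasEdgeConnectivity, isEdgeConnected_iff_le_ncard_cut, not_forall, exists_prop,
    not_le, Nat.lt_succ_iff]

/-- In a `2`-regular graph every cut is even. -/
theorem even_ncard_cut_of_two_regular [Finite V] (h : ∀ v, (G.neighborSet v).ncard = 2)
    (S : Set V) : Even (adjPairs G S Sᶜ).ncard := by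
  classical
  have := Fintype.ofFinite V
  let a : V → V → ZMod 2 := fun x y ↦ if G.Adj x y then 1 else 0
  have hrow : ∀ x, ∑ y, a x y = 0 := by
    intro x
    have : (Finset.univ.filter (G.Adj x)).card = 2 := by
      rw [← h x, Set.ncard_eq_toFinset_card']
      congr 1
      ext; simp
    simp only [a, Finset.sum_boole, this]
    rfl
  -- Each edge inside `S` is counted once in each direction, so it vanishes modulo 2; the degree sum
  -- over `S` therefore has the parity of the cut.
  have hsym : ∑ x ∈ S.toFinset, ∑ y ∈ S.toFinset, a x y = 0 := by
    rw [← Finset.sum_product']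
    refine Finset.sum_involution (fun p _ ↦ p.swap) ?_ ?_ ?_ ?_
    · rintro ⟨x, y⟩ _
      simp only [a, Prod.swap, G.adj_comm y x]
      exact CharTwo.add_self_eq_zero _
    · rintro ⟨x, y⟩ _ hne heq
      have hyx : y = x := congrArg Prod.fst heq
      subst hyx
      simp [a] at hne
    · rintro ⟨x, y⟩ hp
      simpa [and_comm] using hp
    · simp
  have hcut : ((adjPairs G S Sᶜ).ncard : ZMod 2)
      = ∑ x ∈ S.toFinset, ∑ y ∈ Sᶜ.toFinset, a x y := by
    rw [← Finset.sum_product', Finset.sum_boole, Set.ncard_eq_toFinset_card']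
    congr 2
    ext ⟨x, y⟩
    simp [mem_adjPairs, and_assoc]
  have hsplit : ∀ x, ∑ y ∈ S.toFinset, a x y + ∑ y ∈ Sᶜ.toFinset, a x y = 0 := by
    intro x
    rw [← hrow x, Set.toFinset_compl, Finset.sum_add_sum_compl]
  rw [← ZMod.natCast_eq_zero_iff_even, hcut]
  have := Finset.sum_congr rfl fun x (_ : x ∈ S.toFinset) ↦ hsplit x
  rwa [Finset.sum_add_distrib, hsym, zero_add, Finset.sum_const_zero] at this

/-- A Hamiltonian graph has a connected `2`-regular spanning subgraph. -/
theorem SimpleGraph.IsHamiltonian.exists_two_regular [Fintype V] [DecidableEq V]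
    (h : G.IsHamiltonian) (hc : Fintype.card V ≠ 1) :
    ∃ F ≤ G, (∀ v, (F.neighborSet v).ncard = 2) ∧
      ∀ S : Set V, S.Nonempty → Sᶜ.Nonempty →
        2 ≤ (adjPairs F S Sᶜ).ncard ∧ Even (adjPairs F S Sᶜ).ncard := by
  -- By convention `IsHamiltonian` provides a cycle only when the graph does not have exactly one
  -- vertex; this is why `hc` is assumed.
  obtain ⟨a, p, hp⟩ := h hc
  have h2 : ∀ v, (p.toSubgraph.spanningCoe.neighborSet v).ncard = 2 := fun v ↦
    hp.isCycle.ncard_neighborSet_toSubgraph_eq_two (hp.mem_support v)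
  refine ⟨p.toSubgraph.spanningCoe, p.toSubgraph.spanningCoe_le, h2, fun S hS hS' ↦ ?_⟩
  have hev := even_ncard_cut_of_two_regular h2 S
  have hconn : p.toSubgraph.spanningCoe.IsEdgeConnected 1 := by
    rw [isEdgeConnected_one]
    have hs : p.toSubgraph.IsSpanning := fun v ↦ by
      rw [Walk.mem_verts_toSubgraph]; exact hp.mem_support v
    have := p.toSubgraph_connected.coe.preconnected
    exact (Subgraph.spanningCoeEquivCoeOfSpanning _ hs).preconnected_iff.2 this
  have := isEdgeConnected_iff_le_ncard_cut.1 hconn S hS hS'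
  refine ⟨?_, hev⟩
  obtain ⟨k, hk⟩ := hev
  omega

end Cuts

/-! ### Transport along isomorphisms to `Fin n` -/

section Transport

variable {V V' : Type*} {G : SimpleGraph V} {G' : SimpleGraph V'}

theorem IsCubic.of_iso (φ : G ≃g G') (h : IsCubic G) : IsCubic G' := by
  intro v
  obtain ⟨u, rfl⟩ := φ.surjective v
  rw [← h u]
  refine (Set.ncard_congr (fun x _ ↦ φ x) ?_ ?_ ?_).symm
  · intro x hx; exact φ.map_adj_iff.2 hx
  · intro x y _ _ hxy; exact φ.injective hxy
  · intro y hy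
    obtain ⟨x, rfl⟩ := φ.surjective y
    exact ⟨x, φ.map_adj_iff.1 hy, rfl⟩

theorem ncard_cut_preimage (φ : G ≃g G') (S : Set V') :
    (adjPairs G (φ ⁻¹' S) (φ ⁻¹' S)ᶜ).ncard = (adjPairs G' S Sᶜ).ncard := by
  refine Set.ncard_congr (fun p _ ↦ (φ p.1, φ p.2)) ?_ ?_ ?_
  · rintro ⟨x, y⟩ ⟨h1, h2, h3⟩
    exact ⟨h1, h2, φ.map_adj_iff.2 h3⟩
  · rintro ⟨x, y⟩ ⟨x', y'⟩ _ _ h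
    simpa using h
  · rintro ⟨x', y'⟩ ⟨h1, h2, h3⟩
    obtain ⟨x, rfl⟩ := φ.surjective x'
    obtain ⟨y, rfl⟩ := φ.surjective y'
    exact ⟨(x, y), ⟨h1, h2, φ.map_adj_iff.1 h3⟩, rfl⟩

theorem HasEdgeConnectivity.of_iso [Finite V] [Finite V'] {e : ℕ} (φ : G ≃g G')
    (h : HasEdgeConnectivity e G) : HasEdgeConnectivity e G' := by
  rw [hasEdgeConnectivity_iff] at h ⊢
  obtain ⟨h1, S, hS, hS', hle⟩ := h
  refine ⟨fun T hT hT' ↦ ?_, φ.symm ⁻¹' S, ?_, ?_, ?_⟩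
  · rw [← ncard_cut_preimage φ]
    exact h1 _ (hT.preimage φ.surjective) (hT'.preimage φ.surjective)
  · exact hS.preimage φ.symm.surjective
  · exact hS'.preimage φ.symm.surjective
  · rw [ncard_cut_preimage φ.symm]; exact hle

theorem SimpleGraph.IsHamiltonian.of_iso [Fintype V] [Fintype V'] [DecidableEq V]
    [DecidableEq V'] (φ : G ≃g G') (h : G.IsHamiltonian) : G'.IsHamiltonian := by
  intro hc
  obtain ⟨a, p, hp⟩ := h (by rwa [Fintype.card_congr φ.toEquiv])
  exact ⟨φ a, p.map φ.toHom, hp.map φ.bijective⟩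

theorem exists_isPrisonCandidate_of_finite [Fintype V] [DecidableEq V] {g e : ℕ}
    (h3 : IsCubic G) (hg : G.egirth = g) (he : HasEdgeConnectivity e G)
    (hH : ¬ G.IsHamiltonian) :
    ∃ G' : SimpleGraph (Fin (Fintype.card V)), IsPrisonCandidate 3 g e G' := by
  let φ := Iso.map (Fintype.equivFin V) G
  refine ⟨_, ⟨(isRegularOfDegree_three_iff _).2 (h3.of_iso φ), ?_⟩, he.of_iso φ,
    fun h ↦ hH (h.of_iso φ.symm)⟩
  rw [← φ.egirth_eq, hg]

end Transport

/-! ### Girth of Cayley graphs of involutions -/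

section Cayley

variable {Γ : Type*} [Group Γ] {s : Fin 3 → Γ} {r : ℕ}

/-- The Cayley graph of three involutions. -/
def involutionCayley (s : Fin 3 → Γ) (hs : ∀ c, s c * s c = 1) (hs' : ∀ c, s c ≠ 1) :
    SimpleGraph Γ where
  Adj σ ρ := ∃ c, ρ = σ * s c
  symm := ⟨by rintro σ _ ⟨c, rfl⟩; exact ⟨c, by rw [mul_assoc, hs, mul_one]⟩⟩
  loopless := ⟨by rintro σ ⟨c, h⟩; exact hs' c (by simpa using h)⟩

theorem isCubic_involutionCayley (hs : ∀ c, s c * s c = 1) (hs' : ∀ c, s c ≠ 1)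
    (hinj : Function.Injective s) : IsCubic (involutionCayley s hs hs') := by
  intro σ
  have : (involutionCayley s hs hs').neighborSet σ = Set.range fun c ↦ σ * s c := by
    ext ρ
    simp [involutionCayley, eq_comm]
  have hinj' : Function.Injective fun c ↦ σ * s c := (mul_right_injective σ).comp hinj
  rw [this, ← Set.image_univ, Set.ncard_image_of_injective _ hinj', Set.ncard_univ, Nat.card_eq_fintype_card,
    Fintype.card_fin]

/-- The word lists the generators along the trail. Since generators are involutions, a repeated
letter would retrace an edge. The clause on `L.head?` records the first edge, which the induction
needs to detect this. -/
theorem exists_reduced_word_of_isTrail (hs : ∀ c, s c * s c = 1) (hs' : ∀ c, s c ≠ 1) {σ ρ : Γ}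
    (p : (involutionCayley s hs hs').Walk σ ρ) (hp : p.IsTrail) :
    ∃ L : List (Fin 3), L.IsChain (· ≠ ·) ∧ L.length = p.length ∧ ρ = σ * (L.map s).prod ∧
      ∀ c ∈ L.head?, s(σ, σ * s c) ∈ p.edges := by
  induction p with
  | nil => exact ⟨[], by simp⟩
  | @cons a b d h p ih =>
    rw [Walk.isTrail_cons] at hp
    obtain ⟨L, hL, hlen, hprod, hhead⟩ := ih hp.1
    obtain ⟨c, rfl⟩ := h
    refine ⟨c :: L, ?_, congrArg (· + 1) hlen, by simp [hprod, mul_assoc], fun c' hc' ↦ ?_⟩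
    swap
    · obtain rfl : c = c' := by simpa using hc'
      exact List.mem_cons_self
    rw [List.isChain_cons]
    refine ⟨fun c' hc' hcc ↦ hp.2 ?_, hL⟩
    have := hhead c' hc'
    rw [← hcc, mul_assoc, hs, mul_one] at this
    rwa [Sym2.eq_swap]

theorem le_egirth_involutionCayley (hs : ∀ c, s c * s c = 1) (hs' : ∀ c, s c ≠ 1)
    (hr : ∀ L : List (Fin 3), L ≠ [] → L.IsChain (· ≠ ·) → L.length ≤ r → (L.map s).prod ≠ 1) :
    ((r + 1 : ℕ) : ℕ∞) ≤ (involutionCayley s hs hs').egirth := by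
  rw [le_egirth]
  intro a w hw
  obtain ⟨L, hL, hlen, hprod, -⟩ := exists_reduced_word_of_isTrail hs hs' w hw.isTrail
  have h3 := hw.three_le_length
  by_contra hlt
  have hlt' : w.length < r + 1 := by exact_mod_cast not_le.1 hlt
  refine hr L (by rintro rfl; simp at hlen; omega) hL (by omega) ?_
  simpa using hprod.symm

end Cayley

/-! ### Cubic graphs of large girth -/

section ReducedWords

variable {r : ℕ}

/-- Reduced words of length at most `r` in three involutions: the ball of radius `r` in the
`3`-regular tree. -/
abbrev ReducedWord (r : ℕ) := {L : List (Fin 3) // L.IsChain (· ≠ ·) ∧ L.length ≤ r}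

instance finite_reducedWord (r : ℕ) : Finite (ReducedWord r) :=
  ((List.finite_length_le (Fin 3) r).subset fun _ h ↦ h.2).to_subtype

/-- Left multiplication by a generator, wherever the result stays in the ball. -/
def toggle (r : ℕ) (c : Fin 3) (L : ReducedWord r) : ReducedWord r :=
  if L.1.head? = some c then ⟨L.1.tail, L.2.1.tail, by have := L.2.2; simp; omega⟩
  else if h : L.1.length < r ∧ L.1.head? ≠ some c then
    ⟨c :: L.1, by
      rw [List.isChain_cons]
      exact ⟨fun d hd hcd ↦ h.2 (by rw [hcd]; exact hd), L.2.1⟩, by simp; omega⟩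
  else L

theorem toggle_toggle (c : Fin 3) (L : ReducedWord r) : toggle r c (toggle r c L) = L := by
  obtain ⟨L, hL, hlen⟩ := L
  rcases L with _ | ⟨d, L⟩
  · by_cases h : 0 < r <;> simp [toggle, h]
  · by_cases hd : d = c
    · subst hd
      have h1 : L.head? ≠ some d := by
        rw [List.isChain_cons] at hL
        exact fun h ↦ hL.1 d h rfl
      have h2 : L.length < r := by simpa using hlen
      simp [toggle, h1, h2]
    · by_cases h : L.length + 1 < r <;> simp [toggle, h, hd]

/-- The permutation of the ball given by a generator. -/
def togglePerm (r : ℕ) (c : Fin 3) : Equiv.Perm (ReducedWord r) :=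
  Function.Involutive.toPerm (toggle r c) (toggle_toggle c)

/-- Acting on the empty word, a reduced word that fits in the ball writes itself down. Hence no
nonempty reduced word of length at most `r` acts trivially. -/
theorem prod_togglePerm_nil (L : List (Fin 3)) (hL : L.IsChain (· ≠ ·)) (hr : L.length ≤ r) :
    (L.map (togglePerm r)).prod ⟨[], by simp⟩ = ⟨L, hL, hr⟩ := by
  induction L with
  | nil => simp
  | cons c L ih =>
    rw [List.isChain_cons] at hL
    have h1 : L.head? ≠ some c := fun h ↦ hL.1 c h rfl
    have h2 : L.length < r := by simpa using hr
    simp only [List.map_cons, List.prod_cons, Equiv.Perm.mul_apply]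
    rw [ih hL.2 h2.le]
    change toggle r c ⟨L, hL.2, h2.le⟩ = _
    simp [toggle, h1, h2]

/-- There are cubic graphs of arbitrarily large girth. -/
theorem exists_isCubic_le_egirth (g : ℕ) : ∃ (V : Type) (_ : Finite V) (_ : Nonempty V)
    (G : SimpleGraph V), IsCubic G ∧ (g : ℕ∞) ≤ G.egirth := by
  -- Radius `g + 2` instead of `g` makes words of one and two letters available for every `g`; they
  -- show that the generators are nontrivial and distinct.
  have hword : ∀ L : List (Fin 3), L ≠ [] → L.IsChain (· ≠ ·) → L.length ≤ g + 2 →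
      (L.map (togglePerm (g + 2))).prod ≠ 1 := by
    intro L hne hL hlen h
    have := prod_togglePerm_nil L hL hlen
    rw [h] at this
    exact hne (congrArg Subtype.val this).symm
  have hs : ∀ c, togglePerm (g + 2) c * togglePerm (g + 2) c = 1 := fun c ↦
    Equiv.ext fun L ↦ toggle_toggle c L
  have hs' : ∀ c, togglePerm (g + 2) c ≠ 1 := fun c ↦ by
    simpa using hword [c] (by simp) (by simp) (by simp)
  have hinj : Function.Injective (togglePerm (g + 2)) := by
    intro c d hcd
    by_contra hne
    refine hword [c, d] (by simp) (by simpa using hne) (by simp) ?_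
    simp [hcd, hs]
  refine ⟨Equiv.Perm (ReducedWord (g + 2)), inferInstance, inferInstance,
    involutionCayley _ hs hs', isCubic_involutionCayley hs hs' hinj, ?_⟩
  refine le_trans ?_ (le_egirth_involutionCayley hs hs' hword)
  exact_mod_cast (by omega : g ≤ g + 2 + 1)

end ReducedWords

/-! ### Adding a matching -/

section Matching

variable {U : Type*}

/-- Join `t` to `τ t` for every `t ∈ D`. -/
def addMatching (H : SimpleGraph U) (D : Set U) (τ : U → U) : SimpleGraph U :=
  H ⊔ fromRel fun s t ↦ s ∈ D ∧ t = τ s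

variable {H : SimpleGraph U} {D : Set U} {τ : U → U} {g : ℕ}

/-- The certificates serve twice. They bound the girth, and, because the potential jumps by at least
`g - 1 ≥ 2` along a new edge, they show that this edge is neither a loop nor already present. So
each vertex of `D` gains exactly one neighbour. -/
theorem addMatching_spec [Finite U] (hg : 3 ≤ g) (hH : (g : ℕ∞) ≤ H.egirth)
    (hτ : ∀ t ∈ D, τ t ∈ D ∧ τ (τ t) = t)
    (cert : ∀ t ∈ D, ∃ f : U → ℤ, (∀ x y, H.Adj x y → f y ≤ f x + 1) ∧
      (∀ x ∈ D, x ≠ t → x ≠ τ t → f (τ x) ≤ f x + 1) ∧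
      (f t + g ≤ f (τ t) + 1 ∨ f (τ t) + g ≤ f t + 1)) :
    (∀ s t, (addMatching H D τ).Adj s t ↔ H.Adj s t ∨ (s ∈ D ∧ t = τ s)) ∧
    (g : ℕ∞) ≤ (addMatching H D τ).egirth ∧
    (∀ t ∈ D, ((addMatching H D τ).neighborSet t).ncard = (H.neighborSet t).ncard + 1) ∧
    (∀ t ∉ D, ((addMatching H D τ).neighborSet t).ncard = (H.neighborSet t).ncard) := by
  have hne : ∀ t ∈ D, τ t ≠ t ∧ ¬ H.Adj t (τ t) := by
    intro t ht
    obtain ⟨f, hf, -, hft⟩ := cert t ht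
    refine ⟨fun h ↦ ?_, fun h ↦ ?_⟩
    · rw [h] at hft; omega
    · have := hf _ _ h
      have := hf _ _ h.symm
      omega
  have hadj : ∀ s t, (addMatching H D τ).Adj s t ↔ H.Adj s t ∨ (s ∈ D ∧ t = τ s) := by
    intro s t
    simp only [addMatching, sup_adj, fromRel_adj]
    refine or_congr_right ⟨?_, ?_⟩
    · rintro ⟨-, ⟨hs, rfl⟩ | ⟨ht, rfl⟩⟩
      · exact ⟨hs, rfl⟩
      · exact ⟨(hτ t ht).1, (hτ t ht).2.symm⟩
    · rintro ⟨hs, rfl⟩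
      exact ⟨(hne s hs).1.symm, Or.inl ⟨hs, rfl⟩⟩
  refine ⟨hadj, ?_, fun t ht ↦ ?_, fun t ht ↦ ?_⟩
  · refine le_egirth_of_separating hH fun s t hst hnst ↦ ?_
    rw [hadj] at hst
    obtain ⟨hs, rfl⟩ := hst.resolve_left hnst
    obtain ⟨f, hf, hfD, hfs⟩ := cert s hs
    refine ⟨f, fun x y hxy hne' ↦ ?_, hfs⟩
    rw [hadj] at hxy
    rcases hxy with hxy | ⟨hx, rfl⟩
    · exact hf x y hxy
    · refine hfD x hx ?_ ?_
      · rintro rfl; exact hne' rfl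
      · rintro rfl; rw [(hτ s hs).2] at hne'; exact hne' Sym2.eq_swap
  · have : (addMatching H D τ).neighborSet t = insert (τ t) (H.neighborSet t) := by
      ext s
      simp [hadj, ht, or_comm]
    rw [this, Set.ncard_insert_of_notMem (by simpa using (hne t ht).2)]
  · congr 1
    ext s
    simp [hadj, ht]

end Matching

/-! ### Cutting down to a vertex set and rejoining its boundary -/

section Restrict

variable {V : Type} {C : SimpleGraph V} {W : Set V} {g : ℕ}

/-- The edges of `C` inside `W`, as a graph on all vertices. -/
def restrictTo (C : SimpleGraph V) (W : Set V) : SimpleGraph V where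
  Adj x y := x ∈ W ∧ y ∈ W ∧ C.Adj x y
  symm := ⟨fun _ _ h ↦ ⟨h.2.1, h.1, h.2.2.symm⟩⟩
  loopless := ⟨fun _ h ↦ h.2.2.ne rfl⟩

theorem restrictTo_le : restrictTo C W ≤ C := fun _ _ h ↦ h.2.2

/-- The vertices of `W` with a neighbour outside `W`. -/
def innerBoundary (C : SimpleGraph V) (W : Set V) : Set V :=
  {w | w ∈ W ∧ ∃ o, o ∉ W ∧ C.Adj w o}

theorem mem_of_mem_support_restrictTo {x y z : V} (p : (restrictTo C W).Walk x y) (hx : x ∈ W)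
    (hz : z ∈ p.support) : z ∈ W := by
  induction p with
  | nil => simp_all
  | cons h p ih =>
    rw [Walk.support_cons, List.mem_cons] at hz
    rcases hz with rfl | hz
    · exact hx
    · exact ih h.2.1 hz

theorem le_length_add_two_of_restrictTo (hg : (g : ℕ∞) ≤ C.egirth) {a p q : V} (ha : a ∉ W)
    (hpW : p ∈ W) (hp : C.Adj a p) (hq : C.Adj a q) (hpq : p ≠ q)
    (w : (restrictTo C W).Walk p q) : g ≤ w.length + 2 := by
  have := le_length_add_two_of_notMem_support hg hp hq hpq (w.mapLe restrictTo_le)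
    (fun h ↦ ha (mem_of_mem_support_restrictTo w hpW (by simpa using h)))
  simpa using this

/-- A walk inside `W` from `p` to `q` is closed up by the outside path through `a` and `b`, which
adds three edges. -/
theorem le_length_add_three_of_restrictTo (hg : (g : ℕ∞) ≤ C.egirth) {a b p q : V} (ha : a ∉ W)
    (hb : b ∉ W) (hpW : p ∈ W) (hqW : q ∈ W) (hab : C.Adj a b) (hp : C.Adj a p)
    (hq : C.Adj b q) (w : (restrictTo C W).Walk p q) : g ≤ w.length + 3 := by
  have hpb : p ≠ b := fun h ↦ hb (h ▸ hpW)
  have hqa : q ≠ a := fun h ↦ ha (h ▸ hqW)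
  have := le_length_add_one_of_notMem_edges hg hab
    (.cons hp ((w.mapLe restrictTo_le).append (.cons hq.symm .nil))) ?_
  · simpa using this
  · rw [Walk.edges_cons, Walk.edges_append, Walk.edges_cons, Walk.edges_nil]
    simp only [List.mem_cons, List.mem_append, List.not_mem_nil, or_false, not_or]
    refine ⟨?_, fun h ↦ ?_, ?_⟩
    · have := hab.ne
      have := hp.ne
      rw [Sym2.eq_iff]
      aesop
    · have := Walk.fst_mem_support_of_mem_edges _ h
      exact ha (mem_of_mem_support_restrictTo w hpW (by simpa using this))
    · have := hab.ne
      rw [Sym2.eq_iff]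
      aesop

/-- Rejoining the boundary of a vertex set by a matching. -/
theorem exists_isCubic_of_matching [Finite V] (hg : 3 ≤ g) (hC : IsCubic C)
    (hgC : (g : ℕ∞) ≤ C.egirth) (hW : W.Nonempty)
    (hu : ∀ w ∈ W, ∀ o o', o ∉ W → o' ∉ W → C.Adj w o → C.Adj w o' → o = o') (τ : V → V)
    (hτ : ∀ t ∈ innerBoundary C W, τ t ∈ innerBoundary C W ∧ τ (τ t) = t)
    (cert : ∀ t ∈ innerBoundary C W, ∃ f : V → ℤ,
      (∀ x y, (restrictTo C W).Adj x y → f y ≤ f x + 1) ∧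
      (∀ x ∈ innerBoundary C W, x ≠ t → x ≠ τ t → f (τ x) ≤ f x + 1) ∧
      (f t + g ≤ f (τ t) + 1 ∨ f (τ t) + g ≤ f t + 1)) :
    ∃ (U : Type) (_ : Finite U) (_ : Nonempty U) (G : SimpleGraph U),
      IsCubic G ∧ (g : ℕ∞) ≤ G.egirth ∧ Nat.card U = W.ncard := by
  obtain ⟨hadj, hgirth, h2, h3⟩ := addMatching_spec hg
    (hgC.trans (egirth_anti restrictTo_le)) hτ cert
  have hWclosed : ∀ x y, x ∈ W → (addMatching (restrictTo C W) (innerBoundary C W) τ).Adj x y →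
      y ∈ W := by
    intro x y hx hxy
    rw [hadj] at hxy
    rcases hxy with h | ⟨h, rfl⟩
    · exact h.2.1
    · exact (hτ x h).1.1
  refine ⟨W, inferInstance, hW.to_subtype,
    (addMatching (restrictTo C W) (innerBoundary C W) τ).induce W, ?_, ?_, rfl⟩
  · rintro ⟨x, hx⟩
    have : ((addMatching (restrictTo C W) (innerBoundary C W) τ).neighborSet x).ncard = 3 := by
      by_cases hxD : x ∈ innerBoundary C W
      · rw [h2 x hxD]
        obtain ⟨-, o, ho, hxo⟩ := hxD
        -- By `hu` a boundary vertex loses exactly one edge, which the matching restores.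
        have : (restrictTo C W).neighborSet x = C.neighborSet x \ {o} := by
          ext y
          simp only [mem_neighborSet, restrictTo, Set.mem_sdiff, Set.mem_singleton_iff]
          constructor
          · rintro ⟨-, hy, hxy⟩
            exact ⟨hxy, fun h ↦ ho (h ▸ hy)⟩
          · rintro ⟨hxy, hyo⟩
            exact ⟨hx, by_contra fun hy ↦ hyo (hu x hx _ _ hy ho hxy hxo), hxy⟩
        rw [this, Set.ncard_sdiff_singleton_of_mem (s := C.neighborSet x) hxo, hC x]
      · rw [h3 x hxD, ← hC x]
        congr 1
        ext y
        simp only [mem_neighborSet, restrictTo]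
        exact ⟨fun h ↦ h.2.2, fun h ↦ ⟨hx, by_contra fun hy ↦ hxD ⟨hx, y, hy, h⟩, h⟩⟩
    rw [← this]
    refine Set.ncard_congr (fun y _ ↦ y.1) (fun y hy ↦ hy) (fun y z _ _ h ↦ Subtype.ext h)
      fun y hy ↦ ⟨⟨y, hWclosed x y hx hy⟩, hy, rfl⟩
  · exact hgirth.trans (SimpleGraph.Copy.isContained ⟨(Embedding.induce W).toHom,
      Subtype.val_injective⟩).egirth_le

end Restrict

/-! ### Disjoint copies and doubling -/

section Copies

variable {V : Type} {C : SimpleGraph V} {g : ℕ}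

/-- Disjoint copies of a graph. -/
def copies (ι : Type*) (C : SimpleGraph V) : SimpleGraph (ι × V) where
  Adj p q := p.1 = q.1 ∧ C.Adj p.2 q.2
  symm := ⟨fun _ _ h ↦ ⟨h.1.symm, h.2.symm⟩⟩
  loopless := ⟨fun _ h ↦ h.2.ne rfl⟩

variable {ι : Type*}

theorem ncard_neighborSet_copies (i : ι) (x : V) :
    ((copies ι C).neighborSet (i, x)).ncard = (C.neighborSet x).ncard := by
  refine (Set.ncard_congr (t := (copies ι C).neighborSet (i, x)) (fun y _ ↦ (i, y))
    (fun y hy ↦ ⟨rfl, hy⟩) (fun y z _ _ h ↦ (Prod.mk.inj h).2) ?_).symm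
  rintro ⟨j, y⟩ ⟨rfl, hy⟩
  exact ⟨y, hy, rfl⟩

/-- The ends of an edge are separated by a function that is small along all other edges. -/
theorem exists_separating_of_adj (hg : (g : ℕ∞) ≤ C.egirth) {s t : V} (h : C.Adj s t) :
    ∃ f : V → ℤ, (∀ x y, C.Adj x y → s(x, y) ≠ s(s, t) → f y ≤ f x + 1) ∧ f s = 0 ∧
      (∀ x, 0 ≤ f x) ∧ (∀ x, f x ≤ (g - 1 : ℕ)) ∧ f t = (g - 1 : ℕ) := by
  obtain ⟨f, h0, h1, h2, h3, h4⟩ := exists_truncated_dist (C.deleteEdges {s(s, t)}) s (g - 1)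
  refine ⟨f, fun x y hxy hne ↦ h3 x y (deleteEdges_adj.2 ⟨hxy, hne⟩), h0, h1, h2,
    le_antisymm (h2 t) (h4 t _ le_rfl fun p ↦ ?_)⟩
  have := le_length_add_one_of_notMem_edges hg h (p.mapLe (deleteEdges_le _)) ?_
  · simp at this; omega
  · intro hmem
    have : s(s, t) ∈ p.edges := by simpa using hmem
    simpa using p.edges_subset_edgeSet this

theorem le_egirth_copies (hg1 : 1 ≤ g) (hg : (g : ℕ∞) ≤ C.egirth) :
    (g : ℕ∞) ≤ (copies ι C).egirth := by
  classical
  refine le_egirth_of_separating (H := ⊥) (by simp) ?_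
  rintro ⟨i, s⟩ ⟨j, t⟩ ⟨hij, hst⟩ -
  obtain rfl : i = j := hij
  obtain ⟨f, hf, h0, -, -, ht⟩ := exists_separating_of_adj hg (s := s) (t := t) hst
  refine ⟨fun p ↦ if p.1 = i then f p.2 else 0, ?_, by simp [h0, ht]; omega⟩
  rintro ⟨k, x⟩ ⟨l, y⟩ ⟨hkl, hxy⟩ hne
  obtain rfl : k = l := hkl
  by_cases hk : k = i
  · subst hk
    simp only [if_true]
    refine hf x y hxy fun h ↦ hne ?_
    rcases Sym2.eq_iff.1 h with ⟨rfl, rfl⟩ | ⟨rfl, rfl⟩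
    · rfl
    · exact Sym2.eq_swap
  · simp [hk]

/-- Joining the boundaries of two copies of a vertex set. -/
theorem exists_isCubic_of_double {W : Set V} [Finite V] (hg : 3 ≤ g) (hC : IsCubic C)
    (hgC : (g : ℕ∞) ≤ C.egirth) (hW : W.Nonempty)
    (hu : ∀ w ∈ W, ∀ o o', o ∉ W → o' ∉ W → C.Adj w o → C.Adj w o' → o = o') (π : V → V)
    (hπ : ∀ t ∈ innerBoundary C W, π t ∈ innerBoundary C W ∧ π (π t) = t)
    (cert : ∀ t ∈ innerBoundary C W, ∃ f₀ f₁ : V → ℤ,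
      (∀ x y, (restrictTo C W).Adj x y → f₀ y ≤ f₀ x + 1) ∧
      (∀ x y, (restrictTo C W).Adj x y → f₁ y ≤ f₁ x + 1) ∧
      (∀ x ∈ innerBoundary C W, x ≠ t → f₀ x ≤ f₁ (π x) + 1 ∧ f₁ (π x) ≤ f₀ x + 1) ∧
      f₀ t + g ≤ f₁ (π t) + 1) :
    ∃ (U : Type) (_ : Finite U) (_ : Nonempty U) (G : SimpleGraph U),
      IsCubic G ∧ (g : ℕ∞) ≤ G.egirth ∧ Nat.card U = 2 * W.ncard := by
  have hbd : ∀ i x, (i, x) ∈ innerBoundary (copies Bool C) (Set.univ ×ˢ W) ↔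
      x ∈ innerBoundary C W := by
    intro i x
    constructor
    · rintro ⟨h1, ⟨j, o⟩, h2, h3⟩
      exact ⟨h1.2, o, fun h ↦ h2 ⟨trivial, h⟩, h3.2⟩
    · rintro ⟨h1, o, h2, h3⟩
      exact ⟨⟨trivial, h1⟩, (i, o), fun h ↦ h2 h.2, rfl, h3⟩
  have hcard : 2 * W.ncard = ((Set.univ : Set Bool) ×ˢ W).ncard := by
    rw [Set.ncard_prod, Set.ncard_univ]; simp
  rw [hcard]
  refine exists_isCubic_of_matching (C := copies Bool C)
    (W := Set.univ ×ˢ W) hg (fun ⟨i, x⟩ ↦ (ncard_neighborSet_copies i x).trans (hC x))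
    (le_egirth_copies (by omega) hgC) (Set.univ_nonempty.prod hW) ?_
    (fun p ↦ (!p.1, π p.2)) ?_ ?_
  · rintro ⟨i, w⟩ hw ⟨j, o⟩ ⟨k, o'⟩ ho ho' ⟨rfl, h⟩ ⟨rfl, h'⟩
    rw [hu w hw.2 o o' (fun h ↦ ho ⟨trivial, h⟩) (fun h ↦ ho' ⟨trivial, h⟩) h h']
  · rintro ⟨i, t⟩ ht
    rw [hbd] at ht
    simp only [hbd, Bool.not_not]
    exact ⟨(hπ t ht).1, by rw [(hπ t ht).2]⟩
  · rintro ⟨i, t⟩ ht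
    rw [hbd] at ht
    -- The matching joins `(i, x)` to `(!i, π x)`. The pair `f₀`, `f₁` is one potential on both
    -- copies. A new edge leaving `t` in copy `true` is the edge leaving `π t` in copy `false`, so
    -- one orientation suffices.
    have key : ∀ t ∈ innerBoundary C W, ∃ f : Bool × V → ℤ,
        (∀ x y, (restrictTo (copies Bool C) (Set.univ ×ˢ W)).Adj x y → f y ≤ f x + 1) ∧
        (∀ i x, x ∈ innerBoundary C W → (i, x) ≠ (false, t) → (i, x) ≠ (true, π t) →
          f (!i, π x) ≤ f (i, x) + 1) ∧ f (false, t) + g ≤ f (true, π t) + 1 := by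
      intro t ht
      obtain ⟨f₀, f₁, hf₀, hf₁, hx, hgt⟩ := cert t ht
      refine ⟨fun p ↦ if p.1 then f₁ p.2 else f₀ p.2, ?_, ?_, by simpa using hgt⟩
      · rintro ⟨i, x⟩ ⟨j, y⟩ ⟨h1, h2, h3, h4⟩
        obtain rfl : i = j := h3
        cases i
        · simpa using hf₀ x y ⟨h1.2, h2.2, h4⟩
        · simpa using hf₁ x y ⟨h1.2, h2.2, h4⟩
      · intro i x hxD hne hne'
        cases i
        · simpa using (hx x hxD (by simpa using hne)).2
        · have hxt : π x ≠ t := by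
            rintro rfl
            rw [(hπ x hxD).2] at hne'
            exact hne' rfl
          have := (hx (π x) (hπ x hxD).1 hxt).1
          rw [(hπ x hxD).2] at this
          simpa using this
    cases i
    · obtain ⟨f, hf, hx, hgt⟩ := key t ht
      refine ⟨f, hf, ?_, Or.inl hgt⟩
      rintro ⟨i, x⟩ hxD
      rw [hbd] at hxD
      exact hx i x hxD
    · obtain ⟨f, hf, hx, hgt⟩ := key (π t) (hπ t ht).1
      rw [(hπ t ht).2] at hgt hx
      refine ⟨f, hf, ?_, Or.inr hgt⟩
      rintro ⟨i, x⟩ hxD h1 h2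
      rw [hbd] at hxD
      exact hx i x hxD h2 h1

end Copies

/-! ### Naming the neighbours in a cubic graph -/

section Neighbours

variable {V : Type*} {C : SimpleGraph V}

theorem IsCubic.exists_neighbours (h : IsCubic C) (u : V) : ∃ a b c, a ≠ b ∧ a ≠ c ∧ b ≠ c ∧
    ∀ x, C.Adj u x ↔ x = a ∨ x = b ∨ x = c := by
  obtain ⟨a, b, c, h1, h2, h3, h4⟩ := Set.ncard_eq_three.1 (h u)
  exact ⟨a, b, c, h1, h2, h3, fun x ↦ by rw [← mem_neighborSet, h4]; simp⟩

theorem IsCubic.exists_other_neighbours (h : IsCubic C) {u v : V} (huv : C.Adj u v) :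
    ∃ a b, a ≠ b ∧ a ≠ v ∧ b ≠ v ∧ ∀ x, C.Adj u x ↔ x = v ∨ x = a ∨ x = b := by
  obtain ⟨a, b, c, h1, h2, h3, h4⟩ := h.exists_neighbours u
  rcases (h4 v).1 huv with rfl | rfl | rfl
  · exact ⟨b, c, h3, h1.symm, h2.symm, h4⟩
  · exact ⟨a, c, h2, h1, h3.symm, fun x ↦ by rw [h4]; tauto⟩
  · exact ⟨a, b, h1, h2, h3, fun x ↦ by rw [h4]; tauto⟩

theorem IsCubic.exists_third_neighbour (h : IsCubic C) {u v w : V} (huv : C.Adj u v)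
    (huw : C.Adj u w) (hvw : v ≠ w) :
    ∃ a, a ≠ v ∧ a ≠ w ∧ ∀ x, C.Adj u x ↔ x = v ∨ x = w ∨ x = a := by
  obtain ⟨a, b, h1, h2, h3, h4⟩ := h.exists_other_neighbours huv
  rcases (h4 w).1 huw with rfl | rfl | rfl
  · exact absurd rfl hvw
  · exact ⟨b, h3, h1.symm, h4⟩
  · exact ⟨a, h2, h1, fun x ↦ by rw [h4]; tauto⟩

end Neighbours

/-! ### Lowering the girth by deleting an edge with its ends -/

section Reduction

variable {V : Type} {C : SimpleGraph V} {g : ℕ}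

theorem ne_of_adj_of_four_le_egirth (hg : ((4 : ℕ) : ℕ∞) ≤ C.egirth) {u v a c : V}
    (huv : C.Adj u v) (ha : C.Adj u a) (hc : C.Adj v c) : a ≠ c := by
  rintro rfl
  have hau := ha.ne'
  have hav := hc.ne'
  have := le_length_add_three_of_restrictTo (W := {u, v}ᶜ) hg (a := u) (b := v) (p := a) (q := a)
    (by simp) (by simp) (by simp [hau, hav]) (by simp [hau, hav]) huv ha hc .nil
  simp at this

/-- Deleting an edge with both its ends and rejoining the neighbours lowers the girth by at most
one. -/
theorem exists_isCubic_card_lt [Finite V] [Nonempty V] (hg : 3 ≤ g) (hC : IsCubic C)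
    (hgC : ((g + 1 : ℕ) : ℕ∞) ≤ C.egirth) :
    ∃ (U : Type) (_ : Finite U) (_ : Nonempty U) (G : SimpleGraph U),
      IsCubic G ∧ (g : ℕ∞) ≤ G.egirth ∧ Nat.card U < Nat.card V := by
  classical
  obtain ⟨u⟩ := ‹Nonempty V›
  obtain ⟨v, _, _, _, _, _, hv⟩ := hC.exists_neighbours u
  have huv : C.Adj u v := (hv v).2 (Or.inl rfl)
  have hgC4 : ((4 : ℕ) : ℕ∞) ≤ C.egirth :=
    le_trans (by exact_mod_cast (by omega : 4 ≤ g + 1)) hgC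
  have hgC' : (g : ℕ∞) ≤ C.egirth := le_trans (by exact_mod_cast (by omega : g ≤ g + 1)) hgC
  obtain ⟨a, b, hab, hav, hbv, hu⟩ := hC.exists_other_neighbours huv
  obtain ⟨c, d, hcd, hcu, hdu, hv⟩ := hC.exists_other_neighbours huv.symm
  have hua : C.Adj u a := (hu a).2 (by simp)
  have hub : C.Adj u b := (hu b).2 (by simp)
  have hvc : C.Adj v c := (hv c).2 (by simp)
  have hvd : C.Adj v d := (hv d).2 (by simp)
  have hac := ne_of_adj_of_four_le_egirth hgC4 huv hua hvc
  have had := ne_of_adj_of_four_le_egirth hgC4 huv hua hvd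
  have hbc := ne_of_adj_of_four_le_egirth hgC4 huv hub hvc
  have hbd := ne_of_adj_of_four_le_egirth hgC4 huv hub hvd
  have hau := hua.ne'
  have hbu := hub.ne'
  have hcv := hvc.ne'
  have hdv := hvd.ne'
  have hD : ∀ t, t ∈ innerBoundary C {u, v}ᶜ ↔ t = a ∨ t = b ∨ t = c ∨ t = d := by
    intro t
    constructor
    · rintro ⟨ht, o, ho, hto⟩
      rw [Set.notMem_compl_iff] at ho
      rcases ho with rfl | rfl
      · rcases (hu t).1 hto.symm with rfl | h | h
        · simp at ht
        · exact Or.inl h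
        · exact Or.inr (Or.inl h)
      · rcases (hv t).1 hto.symm with rfl | h
        · simp at ht
        · exact Or.inr (Or.inr h)
    · rintro (rfl | rfl | rfl | rfl)
      · exact ⟨by simp [*], u, by simp, hua.symm⟩
      · exact ⟨by simp [*], u, by simp, hub.symm⟩
      · exact ⟨by simp [*], v, by simp, hvc.symm⟩
      · exact ⟨by simp [*], v, by simp, hvd.symm⟩
  let τ : V → V := fun x ↦ if x = a then b else if x = b then a else if x = c then d else c
  have hτa : τ a = b := by simp [τ]
  have hτb : τ b = a := by simp [τ, hab.symm]
  have hτc : τ c = d := by simp [τ, hac.symm, hbc.symm]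
  have hτd : τ d = c := by simp [τ, had.symm, hbd.symm, hcd.symm]
  -- The potential is the distance from `a` after deleting `u` and `v`, truncated at `g - 1`. As the
  -- girth is at least `g + 1`, closing through `u` puts `b` at distance at least `g - 1`, and
  -- closing through `u` and `v` puts `c` and `d` at distance at least `g - 2`. So the new edge `ab`
  -- has the full jump, while `cd` changes by at most one.
  have key : ∀ u v a b c d, C.Adj u v → C.Adj u a → C.Adj u b →
      C.Adj v c → C.Adj v d → a ≠ b → a ≠ v → c ≠ u → d ≠ u → ∃ f : V → ℤ,
      (∀ x y, (restrictTo C {u, v}ᶜ).Adj x y → f y ≤ f x + 1) ∧ f a + g ≤ f b + 1 ∧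
      f c ≤ f d + 1 ∧ f d ≤ f c + 1 := by
    intro u v a b c d huv hua hub hvc hvd hab hav hcu hdu
    obtain ⟨f, h0, h1, h2, h3, h4⟩ := exists_truncated_dist (restrictTo C {u, v}ᶜ) a (g - 1)
    have haW : a ∈ ({u, v}ᶜ : Set V) := by simp [hua.ne', hav]
    have hb := h4 b (g - 1) le_rfl fun p ↦ by
      have := le_length_add_two_of_restrictTo hgC (by simp) haW hua hub hab p
      omega
    have hc := h4 c (g - 2) (by omega) fun p ↦ by
      have := le_length_add_three_of_restrictTo hgC (by simp) (by simp) haW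
        (by simp [hvc.ne', hcu]) huv hua hvc p
      omega
    have hd := h4 d (g - 2) (by omega) fun p ↦ by
      have := le_length_add_three_of_restrictTo hgC (by simp) (by simp) haW
        (by simp [hvd.ne', hdu]) huv hua hvd p
      omega
    have := h2 c
    have := h2 d
    exact ⟨f, h3, by omega, by omega, by omega⟩
  have hswap : ({v, u}ᶜ : Set V) = {u, v}ᶜ := by rw [Set.pair_comm]
  obtain ⟨U, i1, i2, G, h1, h2, h3⟩ : ∃ (U : Type) (_ : Finite U) (_ : Nonempty U)
      (G : SimpleGraph U), IsCubic G ∧ (g : ℕ∞) ≤ G.egirth ∧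
      Nat.card U = ({u, v}ᶜ : Set V).ncard := by
    refine exists_isCubic_of_matching hg hC hgC' ⟨a, by simp [*]⟩ ?_ τ ?_ ?_
    · intro w _ o o' ho ho' hwo hwo'
      rw [Set.notMem_compl_iff] at ho ho'
      rcases ho with rfl | rfl <;> rcases ho' with rfl | rfl
      · rfl
      · exact absurd rfl (ne_of_adj_of_four_le_egirth hgC4 huv hwo.symm hwo'.symm)
      · exact absurd rfl (ne_of_adj_of_four_le_egirth hgC4 huv hwo'.symm hwo.symm)
      · rfl
    · intro t ht
      rw [hD] at ht
      rcases ht with rfl | rfl | rfl | rfl <;> simp [hD, hτa, hτb, hτc, hτd]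
    · intro t ht
      rw [hD] at ht
      simp only [hD]
      rcases ht with h | h | h | h <;> rw [h]
      · obtain ⟨f, hf, h1, h2, h3⟩ := key u v a b c d huv hua hub hvc hvd hab hav hcu hdu
        refine ⟨f, hf, fun x hx hx1 hx2 ↦ ?_, by rw [hτa]; exact Or.inl h1⟩
        rw [hτa] at hx2
        rcases hx with rfl | rfl | rfl | rfl
        · exact absurd rfl hx1
        · exact absurd rfl hx2
        · rw [hτc]; assumption
        · rw [hτd]; assumption
      · obtain ⟨f, hf, h1, h2, h3⟩ := key u v b a c d huv hub hua hvc hvd hab.symm hbv hcu hdu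
        refine ⟨f, hf, fun x hx hx1 hx2 ↦ ?_, by rw [hτb]; exact Or.inl h1⟩
        rw [hτb] at hx2
        rcases hx with rfl | rfl | rfl | rfl
        · exact absurd rfl hx2
        · exact absurd rfl hx1
        · rw [hτc]; assumption
        · rw [hτd]; assumption
      · obtain ⟨f, hf, h1, h2, h3⟩ := key v u c d a b huv.symm hvc hvd hua hub hcd hcu hav hbv
        rw [hswap] at hf
        refine ⟨f, hf, fun x hx hx1 hx2 ↦ ?_, by rw [hτc]; exact Or.inl h1⟩
        rw [hτc] at hx2
        rcases hx with rfl | rfl | rfl | rfl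
        · rw [hτa]; assumption
        · rw [hτb]; assumption
        · exact absurd rfl hx1
        · exact absurd rfl hx2
      · obtain ⟨f, hf, h1, h2, h3⟩ :=
          key v u d c a b huv.symm hvd hvc hua hub hcd.symm hdu hav hbv
        rw [hswap] at hf
        refine ⟨f, hf, fun x hx hx1 hx2 ↦ ?_, by rw [hτd]; exact Or.inl h1⟩
        rw [hτd] at hx2
        rcases hx with rfl | rfl | rfl | rfl
        · rw [hτa]; assumption
        · rw [hτb]; assumption
        · exact absurd rfl hx2
        · exact absurd rfl hx1
  refine ⟨U, i1, i2, G, h1, h2, ?_⟩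
  rw [h3, ← Set.ncard_univ]
  exact Set.ncard_lt_ncard (Set.ssubset_univ_iff.2 fun h ↦ by
    have : u ∈ ({u, v}ᶜ : Set V) := h ▸ trivial
    simp at this)

end Reduction

/-! ### Minimal cubic graphs and their 3-edge-connectivity -/

/-- A cubic graph of girth at least `g` with the fewest vertices. -/
structure IsMinimalCubic (g : ℕ) {V : Type} (C : SimpleGraph V) : Prop where
  isCubic : IsCubic C
  le_egirth : (g : ℕ∞) ≤ C.egirth
  card_le : ∀ (U : Type) [Finite U] [Nonempty U] (G : SimpleGraph U), IsCubic G →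
    (g : ℕ∞) ≤ G.egirth → Nat.card V ≤ Nat.card U

section Minimal

variable {V : Type} {C : SimpleGraph V} {g : ℕ}

theorem IsMinimalCubic.egirth_eq [Finite V] [Nonempty V] (h : IsMinimalCubic g C) (hg : 3 ≤ g) :
    C.egirth = g := by
  refine le_antisymm ?_ h.le_egirth
  by_contra! hlt
  obtain ⟨U, _, _, G, h1, h2, h3⟩ := exists_isCubic_card_lt hg h.isCubic
    (by push_cast; exact Order.add_one_le_of_lt hlt)
  exact absurd (h.card_le U G h1 h2) (by omega)

theorem IsMinimalCubic.card_le_four (h : IsMinimalCubic 3 C) : Nat.card V ≤ 4 := by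
  have := h.card_le (Fin 4) ⊤ (fun v ↦ ?_) three_le_egirth
  · simpa using this
  · rw [neighborSet_top, Set.ncard_compl, Set.ncard_singleton]; simp

/-- This is how minimality contradicts small cuts: `W` is always a proper subset of a side with at
most half the vertices, so the doubled graph would be too small. -/
theorem IsMinimalCubic.le_two_mul_ncard (h : IsMinimalCubic g C) {W : Set V} [Finite V]
    (hg : 3 ≤ g) (hW : W.Nonempty)
    (hu : ∀ w ∈ W, ∀ o o', o ∉ W → o' ∉ W → C.Adj w o → C.Adj w o' → o = o') (π : V → V)
    (hπ : ∀ t ∈ innerBoundary C W, π t ∈ innerBoundary C W ∧ π (π t) = t)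
    (cert : ∀ t ∈ innerBoundary C W, ∃ f₀ f₁ : V → ℤ,
      (∀ x y, (restrictTo C W).Adj x y → f₀ y ≤ f₀ x + 1) ∧
      (∀ x y, (restrictTo C W).Adj x y → f₁ y ≤ f₁ x + 1) ∧
      (∀ x ∈ innerBoundary C W, x ≠ t → f₀ x ≤ f₁ (π x) + 1 ∧ f₁ (π x) ≤ f₀ x + 1) ∧
      f₀ t + g ≤ f₁ (π t) + 1) : Nat.card V ≤ 2 * W.ncard := by
  obtain ⟨U, _, _, G, h1, h2, h3⟩ :=
    exists_isCubic_of_double hg h.isCubic h.le_egirth hW hu π hπ cert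
  exact h3 ▸ h.card_le U G h1 h2

/-- A cut whose edges share an end on one side. -/
theorem IsMinimalCubic.three_le_ncard_of_common_end [Finite V] (h : IsMinimalCubic g C)
    (hg : 3 ≤ g) {S : Set V} (hcard : 2 * S.ncard ≤ Nat.card V) {a : V} (ha : a ∈ S)
    (hcut : ∀ x y, x ∈ S → y ∉ S → C.Adj x y → x = a) : 3 ≤ (adjPairs C S Sᶜ).ncard := by
  have hgC := h.le_egirth
  rcases Set.eq_empty_or_nonempty (S \ {a}) with hW | hW
  · have : S = {a} := Set.Subset.antisymm (Set.sdiff_eq_empty.1 hW) (by simpa using ha)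
    rw [this, ncard_adjPairs_singleton_compl, h.isCubic]
  exfalso
  have hout : ∀ w ∈ S \ {a}, ∀ o, o ∉ S \ {a} → C.Adj w o → o = a := by
    intro w hw o ho hwo
    by_contra hoa
    exact hw.2 (hcut w o hw.1 (fun h ↦ ho ⟨h, hoa⟩) hwo)
  have := h.le_two_mul_ncard hg hW
    (fun w hw o o' ho ho' hwo hwo' ↦ (hout w hw o ho hwo).trans (hout w hw o' ho' hwo').symm)
    id (fun t ht ↦ ⟨ht, rfl⟩) ?_
  · rw [Set.ncard_sdiff_singleton_of_mem ha] at this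
    have : 0 < S.ncard := (Set.ncard_pos).2 ⟨a, ha⟩
    omega
  · rintro t ⟨htW, o, ho, hto⟩
    obtain rfl := hout t htW o ho hto
    -- With the common end deleted, each of its remaining neighbours is joined to its twin. The
    -- first copy carries the distance from `t` truncated at `g - 2`, a value taken at every other
    -- boundary vertex; the second copy is constant at `g - 1`.
    obtain ⟨f, h0, h1, h2, h3, h4⟩ := exists_truncated_dist (restrictTo C (S \ {o})) t (g - 2)
    refine ⟨f, fun _ ↦ (g - 1 : ℕ), h3, by simp, ?_, by dsimp only; omega⟩
    rintro x ⟨hxW, o', ho', hxo⟩ hxt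
    obtain rfl := hout x hxW o' ho' hxo
    have := h4 x (g - 2) le_rfl fun p ↦ by
      have := le_length_add_two_of_restrictTo hgC ho htW hto.symm hxo.symm hxt.symm p
      omega
    have := h2 x
    dsimp only [id]
    omega

/-- A cut of two disjoint edges with adjacent ends on the smaller side. -/
theorem IsMinimalCubic.false_of_adj_ends [Finite V] (h : IsMinimalCubic g C) (hg : 4 ≤ g)
    {S : Set V} (hcard : 2 * S.ncard ≤ Nat.card V) {a b a' b' : V} (ha : a ∈ S) (ha' : a' ∈ S)
    (hb : b ∉ S) (hb' : b' ∉ S) (hab : C.Adj a b) (hab' : C.Adj a' b') (haa : C.Adj a a')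
    (hcut : ∀ x y, x ∈ S → y ∉ S → C.Adj x y → (x = a ∧ y = b) ∨ (x = a' ∧ y = b')) : False := by
  have hgC := h.le_egirth
  have hgC4 : ((4 : ℕ) : ℕ∞) ≤ C.egirth := le_trans (by exact_mod_cast hg) hgC
  obtain ⟨p, hpb, hpa', hp⟩ := h.isCubic.exists_third_neighbour hab haa
    (fun h ↦ hb (h ▸ ha'))
  obtain ⟨q, hqb, hqa, hq⟩ := h.isCubic.exists_third_neighbour hab' haa.symm
    (fun h ↦ hb' (h ▸ ha))
  have hap : C.Adj a p := (hp p).2 (by simp)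
  have haq : C.Adj a' q := (hq q).2 (by simp)
  have hpS : p ∈ S := by
    by_contra hpS
    rcases hcut a p ha hpS hap with h | h
    · exact hpb h.2
    · exact haa.ne h.1
  have hqS : q ∈ S := by
    by_contra hqS
    rcases hcut a' q ha' hqS haq with h | h
    · exact haa.ne' h.1
    · exact hqb h.2
  have hpW : p ∈ S \ {a, a'} := ⟨hpS, by simp [hap.ne', hpa']⟩
  have hqW : q ∈ S \ {a, a'} := ⟨hqS, by simp [haq.ne', hqa]⟩
  have haW : a ∉ S \ {a, a'} := by simp
  have haW' : a' ∉ S \ {a, a'} := by simp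
  have hout : ∀ w ∈ S \ {a, a'}, ∀ o, o ∉ S \ {a, a'} → C.Adj w o →
      (w = p ∧ o = a) ∨ (w = q ∧ o = a') := by
    rintro w ⟨hwS, hw⟩ o ho hwo
    simp only [Set.mem_insert_iff, Set.mem_singleton_iff, not_or] at hw
    by_cases hoS : o ∈ S
    · have : o = a ∨ o = a' := by simpa [hoS, or_iff_not_imp_left] using ho
      rcases this with rfl | rfl
      · rcases (hp w).1 hwo.symm with rfl | rfl | rfl
        · exact absurd hwS hb
        · exact absurd rfl hw.2
        · exact Or.inl ⟨rfl, rfl⟩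
      · rcases (hq w).1 hwo.symm with rfl | rfl | rfl
        · exact absurd hwS hb'
        · exact absurd rfl hw.1
        · exact Or.inr ⟨rfl, rfl⟩
    · rcases hcut w o hwS hoS hwo with h | h
      · exact absurd h.1 hw.1
      · exact absurd h.1 hw.2
  have hpq : p ≠ q := ne_of_adj_of_four_le_egirth hgC4 haa hap haq
  have hbound : ∀ t, t ∈ innerBoundary C (S \ {a, a'}) → t = p ∨ t = q := by
    rintro t ⟨ht, o, ho, hto⟩
    rcases hout t ht o ho hto with h | h
    · exact Or.inl h.1
    · exact Or.inr h.1
  -- Both ends are deleted, and `p`, `q`, now at distance at least `g - 3`, are joined to their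
  -- twins. A cycle through both new edges has length at least `2 (g - 3) + 2`, hence at least `g`
  -- because `g ≥ 4`.
  have key : ∀ x y, x ∈ S \ {a, a'} →
      (∀ w : (restrictTo C (S \ {a, a'})).Walk x y, g ≤ w.length + 3) →
      ∃ f₀ f₁ : V → ℤ, (∀ x y, (restrictTo C (S \ {a, a'})).Adj x y → f₀ y ≤ f₀ x + 1) ∧
      (∀ x y, (restrictTo C (S \ {a, a'})).Adj x y → f₁ y ≤ f₁ x + 1) ∧
      (f₀ y ≤ f₁ y + 1 ∧ f₁ y ≤ f₀ y + 1) ∧ f₀ x + g ≤ f₁ x + 1 := by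
    intro x y hx hw
    obtain ⟨f, h0, h1, h2, h3, h4⟩ := exists_truncated_dist (restrictTo C (S \ {a, a'})) x (g - 3)
    have hy := h4 y (g - 3) le_rfl fun p ↦ by have := hw p; omega
    have hy' := h2 y
    refine ⟨f, fun z ↦ max (g - 1 - f z) (g - 2), h3, fun z w hzw ↦ ?_, ?_, ?_⟩
    · have := h3 w z hzw.symm
      dsimp only
      omega
    · dsimp only; omega
    · dsimp only; omega
  have := h.le_two_mul_ncard (W := S \ {a, a'}) (by omega) ⟨p, hpW⟩ ?_ id (fun t ht ↦ ⟨ht, rfl⟩) ?_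
  · have h2 : (S \ {a, a'}).ncard < S.ncard :=
      Set.ncard_lt_ncard ⟨Set.sdiff_subset, fun hsub ↦ haW (hsub ha)⟩
    omega
  · intro w hw o o' ho ho' hwo hwo'
    rcases hout w hw o ho hwo with ⟨h1, h2⟩ | ⟨h1, h2⟩ <;>
      rcases hout w hw o' ho' hwo' with ⟨h3, h4⟩ | ⟨h3, h4⟩
    · exact h2.trans h4.symm
    · exact absurd (h1.symm.trans h3) hpq
    · exact absurd (h3.symm.trans h1) hpq
    · exact h2.trans h4.symm
  · intro t ht
    rcases hbound t ht with rfl | rfl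
    · obtain ⟨f₀, f₁, h1, h2, h3, h4⟩ := key t q hpW fun w ↦
        le_length_add_three_of_restrictTo hgC haW haW' hpW hqW haa hap haq w
      refine ⟨f₀, f₁, h1, h2, fun x hx hxt ↦ ?_, h4⟩
      rcases hbound x hx with rfl | rfl
      · exact absurd rfl hxt
      · exact h3
    · obtain ⟨f₀, f₁, h1, h2, h3, h4⟩ := key t p hqW fun w ↦
        le_length_add_three_of_restrictTo hgC haW' haW hqW hpW haa.symm haq hap w
      refine ⟨f₀, f₁, h1, h2, fun x hx hxt ↦ ?_, h4⟩
      rcases hbound x hx with rfl | rfl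
      · exact h3
      · exact absurd rfl hxt

end Minimal

section Minimal

variable {V : Type} {C : SimpleGraph V} {g : ℕ}

theorem sub_le_length_of_lipschitz {G : SimpleGraph V} {f : V → ℤ}
    (hf : ∀ x y, G.Adj x y → f y ≤ f x + 1) {u v : V} (p : G.Walk u v) :
    f v ≤ f u + p.length := by
  induction p with
  | nil => simp
  | cons h p ih =>
    have := hf _ _ h
    rw [Walk.length_cons]
    push_cast
    omega

/-- A cut of two disjoint edges with non-adjacent ends on the smaller side. -/
theorem IsMinimalCubic.false_of_not_adj_ends [Finite V] (h : IsMinimalCubic g C) (hg : 3 ≤ g)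
    {S : Set V} (hcard : 2 * S.ncard ≤ Nat.card V) {a b a' b' : V} (ha : a ∈ S) (ha' : a' ∈ S)
    (hb : b ∉ S) (hb' : b' ∉ S) (hab : C.Adj a b) (hab' : C.Adj a' b') (hne : a ≠ a')
    (haa : ¬ C.Adj a a')
    (hcut : ∀ x y, x ∈ S → y ∉ S → C.Adj x y → (x = a ∧ y = b) ∨ (x = a' ∧ y = b')) : False := by
  classical
  have hgC := h.le_egirth
  obtain ⟨p, q, hpq, hpb, hqb, hN⟩ := h.isCubic.exists_other_neighbours hab
  have hap : C.Adj a p := (hN p).2 (by simp)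
  have haq : C.Adj a q := (hN q).2 (by simp)
  have hpa' : p ≠ a' := fun e ↦ haa (e ▸ hap)
  have hqa' : q ≠ a' := fun e ↦ haa (e ▸ haq)
  have hpS : p ∈ S := by
    by_contra hpS
    rcases hcut a p ha hpS hap with h | h
    · exact hpb h.2
    · exact hne h.1
  have hqS : q ∈ S := by
    by_contra hqS
    rcases hcut a q ha hqS haq with h | h
    · exact hqb h.2
    · exact hne h.1
  have haW : a ∉ S \ {a} := by simp
  have hpW : p ∈ S \ {a} := ⟨hpS, hap.ne'⟩
  have hqW : q ∈ S \ {a} := ⟨hqS, haq.ne'⟩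
  have haW' : a' ∈ S \ {a} := ⟨ha', hne.symm⟩
  have hout : ∀ w ∈ S \ {a}, ∀ o, o ∉ S \ {a} → C.Adj w o →
      ((w = p ∨ w = q) ∧ o = a) ∨ (w = a' ∧ o = b') := by
    rintro w ⟨hwS, hw⟩ o ho hwo
    by_cases hoS : o ∈ S
    · have hoa : o = a := by simpa [hoS] using ho
      rw [hoa] at hwo
      rcases (hN w).1 hwo.symm with rfl | h
      · exact absurd hwS hb
      · exact Or.inl ⟨h, hoa⟩
    · rcases hcut w o hwS hoS hwo with h | h
      · exact absurd h.1 hw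
      · exact Or.inr h
  have hD : ∀ t, t ∈ innerBoundary C (S \ {a}) ↔ t = p ∨ t = q ∨ t = a' := by
    intro t
    constructor
    · rintro ⟨ht, o, ho, hto⟩
      have := hout t ht o ho hto
      tauto
    · rintro (rfl | rfl | rfl)
      · exact ⟨hpW, a, haW, hap.symm⟩
      · exact ⟨hqW, a, haW, haq.symm⟩
      · exact ⟨haW', b', fun h ↦ hb' h.1, hab'⟩
  -- Only `a` is deleted, leaving the boundary `p`, `q`, `a'`. The copies are glued with a twist:
  -- `p` to the twin of `q`, `q` to the twin of `p`, `a'` to its own twin. A cycle going from `p` to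
  -- `a'` in one copy returns from `a'` to `q` in the other, and these two distances add up to at
  -- least `g - 2`. Without the twist the same short distance could occur twice.
  let π : V → V := Equiv.swap p q
  have hπp : π p = q := Equiv.swap_apply_left p q
  have hπq : π q = p := Equiv.swap_apply_right p q
  have hπa : π a' = a' := Equiv.swap_apply_of_ne_of_ne hpa'.symm hqa'.symm
  obtain ⟨d, d0, d1, d2, d3, d4⟩ := exists_truncated_dist (restrictTo C (S \ {a})) p (g - 2)
  obtain ⟨e, e0, e1, e2, e3, e4⟩ := exists_truncated_dist (restrictTo C (S \ {a})) q (g - 2)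
  have hdq := d4 q (g - 2) le_rfl fun w ↦ by
    have := le_length_add_two_of_restrictTo hgC haW hpW hap haq hpq w
    omega
  have hep := e4 p (g - 2) le_rfl fun w ↦ by
    have := le_length_add_two_of_restrictTo hgC haW hqW haq hap hpq.symm w
    omega
  -- The triangle inequality through `a'`, adapted to truncated distances.
  have hsum : (g : ℤ) - 2 ≤ d a' + e a' := by
    have h1 := d1 a'
    have h2 := d2 a'
    have := e4 a' (g - 2 - (d a').toNat) (by omega) fun w ↦ by
      have := sub_le_length_of_lipschitz d3 w.reverse
      rw [Walk.length_reverse] at this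
      omega
    omega
  have hdq' := d2 q
  have hep' := e2 p
  have hda := d1 a'
  have hda' := d2 a'
  have hea := e1 a'
  have hea' := e2 a'
  have := h.le_two_mul_ncard (W := S \ {a}) hg ⟨p, hpW⟩ ?_ π ?_ ?_
  · have h2 : (S \ {a}).ncard < S.ncard :=
      Set.ncard_lt_ncard ⟨Set.sdiff_subset, fun hsub ↦ haW (hsub ha)⟩
    omega
  · intro w hw o o' ho ho' hwo hwo'
    rcases hout w hw o ho hwo with ⟨h1, h2⟩ | ⟨h1, h2⟩ <;>
      rcases hout w hw o' ho' hwo' with ⟨h3, h4⟩ | ⟨h3, h4⟩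
    · exact h2.trans h4.symm
    · rcases h1 with h1 | h1
      · exact absurd (h1.symm.trans h3) hpa'
      · exact absurd (h1.symm.trans h3) hqa'
    · rcases h3 with h3 | h3
      · exact absurd (h3.symm.trans h1) hpa'
      · exact absurd (h3.symm.trans h1) hqa'
    · exact h2.trans h4.symm
  · intro t ht
    simp only [hD] at ht ⊢
    rcases ht with h | h | h <;> rw [h]
    · exact ⟨by simp [hπp], by rw [hπp, hπq]⟩
    · exact ⟨by simp [hπq], by rw [hπq, hπp]⟩
    · exact ⟨by simp [hπa], by rw [hπa, hπa]⟩
  · intro t ht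
    simp only [hD] at ht ⊢
    rcases ht with h | h | h <;> rw [h]
    -- Clipping at `d a'` and `d a' + 1` makes the two sides differ by exactly one on the other two
    -- gluing edges; `hsum` is what makes this work at `a'`.
    · refine ⟨fun x ↦ min (d x) (d a'), fun x ↦ max (g - 1 - e x) (d a' + 1), ?_, ?_, ?_, ?_⟩
      · intro x y hxy
        have := d3 x y hxy
        dsimp only; omega
      · intro x y hxy
        have := e3 y x hxy.symm
        dsimp only; omega
      · rintro x (hx | hx | hx) hxt <;> rw [hx]
        · exact absurd hx hxt
        · rw [hπq]; dsimp only; omega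
        · rw [hπa]; dsimp only; omega
      · rw [hπp]; dsimp only; omega
    · refine ⟨fun x ↦ min (e x) (e a'), fun x ↦ max (g - 1 - d x) (e a' + 1), ?_, ?_, ?_, ?_⟩
      · intro x y hxy
        have := e3 x y hxy
        dsimp only; omega
      · intro x y hxy
        have := d3 y x hxy.symm
        dsimp only; omega
      · rintro x (hx | hx | hx) hxt <;> rw [hx]
        · rw [hπp]; dsimp only; omega
        · exact absurd hx hxt
        · rw [hπa]; dsimp only; omega
      · rw [hπq]; dsimp only; omega
    -- The maximum replaces the distance from `a'`: it is `0` at `a'`, `d a'` at `p` and `g - 2 - d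
    -- a'` at `q`. The last two sum to `g - 2`, so the twisted edges change by one.
    · refine ⟨fun x ↦ max (max (d a' - d x) (g - 2 - d a' - e x)) 0,
        fun x ↦ g - 1 - max (max (d a' - d x) (g - 2 - d a' - e x)) 0, ?_, ?_, ?_, ?_⟩
      · intro x y hxy
        have := d3 y x hxy.symm
        have := e3 y x hxy.symm
        dsimp only; omega
      · intro x y hxy
        have := d3 x y hxy
        have := e3 x y hxy
        dsimp only; omega
      · rintro x (hx | hx | hx) hxt <;> rw [hx]
        · rw [hπp]; dsimp only; omega
        · rw [hπq]; dsimp only; omega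
        · exact absurd hx hxt
      · rw [hπa]; dsimp only; omega

/-- A minimal cubic graph of girth at least `g` is `3`-edge-connected. -/
theorem IsMinimalCubic.three_le_ncard_cut [Finite V] (h : IsMinimalCubic g C) (hg : 3 ≤ g)
    {S : Set V} (hS : S.Nonempty) (hS' : Sᶜ.Nonempty) : 3 ≤ (adjPairs C S Sᶜ).ncard := by
  wlog hcard : 2 * S.ncard ≤ Nat.card V generalizing S
  · rw [ncard_adjPairs_comm]
    have := this hS' (by rwa [compl_compl]) (by have := Set.ncard_add_ncard_compl S; omega)
    rwa [compl_compl] at this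
  by_contra! hlt
  have hno : ∀ a ∈ S, ∃ x y, x ∈ S ∧ y ∉ S ∧ C.Adj x y ∧ x ≠ a := by
    intro a ha
    by_contra! hcon
    exact absurd (h.three_le_ncard_of_common_end hg hcard ha hcon) (by omega)
  obtain ⟨a₀, ha₀⟩ := hS
  obtain ⟨a, b, ha, hb, hab, -⟩ := hno a₀ ha₀
  obtain ⟨a', b', ha', hb', hab', hne⟩ := hno a ha
  have hcutset : {(a, b), (a', b')} = adjPairs C S Sᶜ := by
    refine Set.eq_of_subset_of_ncard_le ?_ ?_ (Set.toFinite _)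
    · rintro x (rfl | rfl)
      · exact ⟨ha, hb, hab⟩
      · exact ⟨ha', hb', hab'⟩
    · rw [Set.ncard_pair (fun e ↦ hne (Prod.mk.inj e).1.symm)]
      omega
  have hcut : ∀ x y, x ∈ S → y ∉ S → C.Adj x y → (x = a ∧ y = b) ∨ (x = a' ∧ y = b') := by
    intro x y hx hy hxy
    have : (x, y) ∈ ({(a, b), (a', b')} : Set (V × V)) := hcutset ▸ ⟨hx, hy, hxy⟩
    simpa using this
  by_cases haa : C.Adj a a'
  · refine h.false_of_adj_ends ?_ hcard ha ha' hb hb' hab hab' haa hcut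
    by_contra! hg4
    -- For girth 3 the complete graph on four vertices bounds the order by 4, whereas `S` already
    -- contains three vertices and is at most half of the graph.
    obtain rfl : g = 3 := by omega
    have h4 := h.card_le_four
    obtain ⟨p, hpb, hpa, hp⟩ := h.isCubic.exists_third_neighbour hab haa (fun e ↦ hb (e ▸ ha'))
    have hap := (hp p).2 (by simp)
    have hpS : p ∈ S := by
      by_contra hpS
      rcases hcut a p ha hpS hap with e | e
      · exact hpb e.2
      · exact hne e.1.symm
    have h3 : ({a, a', p} : Set V).ncard = 3 :=
      Set.ncard_eq_three.2 ⟨a, a', p, haa.ne, hap.ne, hpa.symm, rfl⟩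
    have : ({a, a', p} : Set V).ncard ≤ S.ncard :=
      Set.ncard_le_ncard (by rintro x (rfl | rfl | rfl) <;> assumption)
    omega
  · exact h.false_of_not_adj_ends hg hcard ha ha' hb hb' hab hab' hne.symm haa hcut

end Minimal

/-! ### A shortest cycle that misses a vertex -/

section Chordless

variable {V : Type} {C : SimpleGraph V} {g : ℕ}

/-- A neighbour along an edge outside a shortest cycle does not lie on the cycle. -/
theorem notMem_support_of_notMem_edges (hg : 3 ≤ g) (hC : C.egirth = g) {a y : V}
    (w : C.Walk a a) (hlen : w.length = g) (hay : C.Adj a y) (hy : s(a, y) ∉ w.edges) :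
    y ∉ w.support := by
  classical
  intro hmem
  -- A chord would leave two arcs of length at least `g - 1` each, of total length `g`,
  -- contradicting `g ≥ 3`.
  have h1 := le_length_add_one_of_notMem_edges hC.ge hay (w.takeUntil y hmem)
    fun h ↦ hy (w.edges_takeUntil_subset_edges hmem h)
  have h2 := le_length_add_one_of_notMem_edges hC.ge hay.symm (w.dropUntil y hmem)
    fun h ↦ hy (by rw [Sym2.eq_swap]; exact w.edges_dropUntil_subset_edges hmem h)
  have h3 := congrArg Walk.length (w.take_spec hmem)
  rw [Walk.length_append] at h3
  omega

/-- A cubic graph keeps its girth when a suitable vertex is deleted. -/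
theorem IsCubic.exists_egirth_induce_le [Finite V] (h : IsCubic C) (hg : 3 ≤ g)
    (hC : C.egirth = g) : ∃ z, (C.induce {z}ᶜ).egirth ≤ g := by
  have hac : ¬ C.IsAcyclic := fun hac ↦ by
    rw [hac.egirth_eq_top] at hC
    exact ENat.natCast_ne_top g hC.symm
  obtain ⟨a, w, hw, hlen⟩ := exists_egirth_eq_length.2 hac
  have hlen' : w.length = g := by
    rw [hC] at hlen
    exact_mod_cast hlen.symm
  have h2 := hw.ncard_neighborSet_toSubgraph_eq_two w.start_mem_support
  have h3 := h a
  obtain ⟨y, hy, hy'⟩ : ∃ y ∈ C.neighborSet a, y ∉ w.toSubgraph.neighborSet a := by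
    by_contra! hcon
    have := Set.ncard_le_ncard (s := C.neighborSet a) hcon (Set.toFinite _)
    omega
  have hyw := notMem_support_of_notMem_edges hg hC w hlen' hy
    fun hmem ↦ hy' (Walk.adj_toSubgraph_iff_mem_edges.2 hmem)
  have hsub : ∀ x ∈ w.support, x ∈ ({y}ᶜ : Set V) := by
    rintro x hx rfl
    exact hyw hx
  refine ⟨y, ?_⟩
  have hcyc : (w.induce _ hsub).IsCycle := by
    refine (Walk.isCycle_map_iff_of_injective (f := (Embedding.induce ({y}ᶜ : Set V)).toHom)
      Subtype.val_injective).1 ?_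
    rwa [Walk.map_induce]
  refine (egirth_le_length hcyc).trans ?_
  have := congrArg Walk.length (w.map_induce hsub)
  rw [Walk.length_map] at this
  exact_mod_cast (this.trans hlen').le

theorem egirth_le_of_hom_injective {V' : Type*} {G : SimpleGraph V} {G' : SimpleGraph V'}
    (f : V → V') (hf : Function.Injective f) (h : ∀ x y, G.Adj x y → G'.Adj (f x) (f y)) :
    G'.egirth ≤ G.egirth :=
  SimpleGraph.IsContained.egirth_le ⟨⟨⟨f, fun hxy ↦ h _ _ hxy⟩, hf⟩⟩

theorem adjPairs_mono {G G' : SimpleGraph V} (h : G ≤ G') (A B : Set V) :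
    adjPairs G A B ⊆ adjPairs G' A B := fun _ hp ↦ ⟨hp.1, hp.2.1, h hp.2.2⟩

end Chordless

/-! ### Edge-connectivity one: two copies joined by a bridge -/

section Bridged

variable {V : Type} {C : SimpleGraph V} {u v : V} {g : ℕ}

/-- Subdivide the edge `uv` of `C` by a new vertex `none`. -/
def subdivide (C : SimpleGraph V) (u v : V) : SimpleGraph (Option V) where
  Adj
    | some x, some y => C.Adj x y ∧ s(x, y) ≠ s(u, v)
    | some x, none => x = u ∨ x = v
    | none, some y => y = u ∨ y = v
    | none, none => False
  symm := ⟨by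
    rintro (_ | x) (_ | y) h
    · exact h
    · exact h
    · exact h
    · exact ⟨h.1.symm, by rw [Sym2.eq_swap]; exact h.2⟩⟩
  loopless := ⟨by
    rintro (_ | x) h
    · exact h
    · exact h.1.ne rfl⟩

theorem ncard_neighborSet_subdivide_some (huv : C.Adj u v) (x : V) :
    ((subdivide C u v).neighborSet (some x)).ncard = (C.neighborSet x).ncard := by
  classical
  refine (Set.ncard_congr (t := (subdivide C u v).neighborSet (some x))
    (fun y _ ↦ if s(x, y) = s(u, v) then none else some y) ?_ ?_ ?_).symm
  · intro y hy
    split_ifs with h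
    · rcases Sym2.eq_iff.1 h with h | h
      · exact Or.inl h.1
      · exact Or.inr h.1
    · exact ⟨hy, h⟩
  · intro y y' hy hy' h
    split_ifs at h with h1 h2 h2
    · exact Sym2.congr_right.1 (h1.trans h2.symm)
    · exact Option.some_injective _ h
  · rintro (_ | y) hy
    · rcases hy with rfl | rfl
      · exact ⟨v, huv, by simp⟩
      · exact ⟨u, huv.symm, by simp⟩
    · exact ⟨y, hy.1, if_neg hy.2⟩

theorem ncard_neighborSet_subdivide_none (huv : C.Adj u v) :
    ((subdivide C u v).neighborSet none).ncard = 2 := by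
  have : (subdivide C u v).neighborSet none = {some u, some v} := by
    ext (_ | y)
    · simp only [mem_neighborSet, Set.mem_insert_iff, Set.mem_singleton_iff, reduceCtorEq, or_self,
        iff_false]
      exact fun h ↦ h
    · simp only [mem_neighborSet, Set.mem_insert_iff, Set.mem_singleton_iff, Option.some.injEq]
      exact Iff.rfl
  rw [this, Set.ncard_pair (by simpa using huv.ne)]

/-- Potentials of `C` extend to the new vertex. For a half of the subdivided edge, the new vertex
takes the value at the far end, so that half carries the whole jump. For any other edge it takes the
value at `u`, which differs from that at `v` by at most one. -/
theorem le_egirth_subdivide (hg1 : 1 ≤ g) (hg : (g : ℕ∞) ≤ C.egirth) (huv : C.Adj u v) :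
    (g : ℕ∞) ≤ (subdivide C u v).egirth := by
  have key : ∀ a b, C.Adj a b → s(a, b) = s(u, v) → ∃ f : Option V → ℤ,
      (∀ x y, (subdivide C u v).Adj x y → s(x, y) ≠ s(some a, none) → f y ≤ f x + 1) ∧
      f (some a) + g ≤ f none + 1 := by
    intro a b hab he
    obtain ⟨f, hf, h0, -, -, ht⟩ := exists_separating_of_adj hg hab
    refine ⟨fun x ↦ x.elim (f b) f, ?_, by dsimp only [Option.elim]; omega⟩
    have hend : ∀ y, (y = u ∨ y = v) → y = a ∨ y = b := by
      intro y hy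
      have : y ∈ s(u, v) := by simpa using hy
      rw [← he] at this
      simpa using this
    rintro (_ | x) (_ | y) h hne
    · exact h.elim
    · rcases hend y h with rfl | rfl
      · exact absurd Sym2.eq_swap hne
      · simp
    · rcases hend x h with rfl | rfl
      · exact absurd rfl hne
      · simp
    · exact hf x y h.1 (by rw [he]; exact h.2)
  refine le_egirth_of_separating (H := ⊥) (by simp) ?_
  rintro (_ | s) (_ | t) hst -
  · exact hst.elim
  · rcases hst with rfl | rfl
    · obtain ⟨f, h1, h2⟩ := key t v huv rfl
      exact ⟨f, by rwa [Sym2.eq_swap], Or.inr h2⟩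
    · obtain ⟨f, h1, h2⟩ := key t u huv.symm Sym2.eq_swap
      exact ⟨f, by rwa [Sym2.eq_swap], Or.inr h2⟩
  · rcases hst with rfl | rfl
    · obtain ⟨f, h1, h2⟩ := key s v huv rfl
      exact ⟨f, h1, Or.inl h2⟩
    · obtain ⟨f, h1, h2⟩ := key s u huv.symm Sym2.eq_swap
      exact ⟨f, h1, Or.inl h2⟩
  · obtain ⟨f, hf, h0, -, -, ht⟩ := exists_separating_of_adj hg hst.1
    have huv1 := hf u v huv (Ne.symm hst.2)
    have huv2 := hf v u huv.symm (by rw [Sym2.eq_swap]; exact Ne.symm hst.2)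
    refine ⟨fun x ↦ x.elim (f u) f, ?_, Or.inl (by dsimp only [Option.elim]; omega)⟩
    rintro (_ | x) (_ | y) h hne
    · exact h.elim
    · rcases h with rfl | rfl
      · simp
      · exact huv1
    · rcases h with rfl | rfl
      · simp
      · exact huv2
    · refine hf x y h.1 fun he ↦ hne ?_
      rcases Sym2.eq_iff.1 he with ⟨rfl, rfl⟩ | ⟨rfl, rfl⟩
      · rfl
      · exact Sym2.eq_swap

/-- Two copies of a cubic graph, joined by a bridge between subdivided edges. -/
theorem exists_isPrisonCandidate_one [Fintype V] [DecidableEq V] (hC : IsCubic C) (hg : 3 ≤ g)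
    (hgC : C.egirth = g) (hcut : ∀ S : Set V, S.Nonempty → Sᶜ.Nonempty →
      3 ≤ (adjPairs C S Sᶜ).ncard) (hu : (C.induce {u}ᶜ).egirth ≤ g) :
    ∃ G : SimpleGraph (Fin (2 * Fintype.card V + 2)), IsPrisonCandidate 3 g 1 G := by
  obtain ⟨v, _, _, _, _, _, hN⟩ := hC.exists_neighbours u
  have huv : C.Adj u v := (hN v).2 (Or.inl rfl)
  obtain ⟨hadj, hgirth, hD, hD'⟩ := addMatching_spec (H := copies Bool (subdivide C u v))
    (D := {p | p.2 = none}) (τ := fun p ↦ (!p.1, p.2)) hg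
    (le_egirth_copies (by omega) (le_egirth_subdivide (by omega) hgC.ge huv))
    (by rintro ⟨i, x⟩ h; simpa using h) (by
      rintro ⟨i, x⟩ h
      obtain rfl : x = none := h
      -- The new edge is a bridge, so a potential constant on each copy certifies it.
      refine ⟨fun p ↦ if p.1 = i then 0 else g - 1, ?_, ?_, by simp⟩
      · rintro ⟨j, x⟩ ⟨k, y⟩ ⟨h1, -⟩
        obtain rfl : j = k := h1
        simp
      · rintro ⟨j, x⟩ h h1 h2
        obtain rfl : x = none := h
        cases i <;> cases j <;> simp_all)
  set G := addMatching (copies Bool (subdivide C u v)) {p | p.2 = none} (fun p ↦ (!p.1, p.2))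
  have hbridge : (adjPairs G {p | p.1 = true} {p | p.1 = true}ᶜ).ncard ≤ 1 := by
    rw [← Set.ncard_singleton (((true, none), (false, none)) :
      (Bool × Option V) × (Bool × Option V))]
    refine Set.ncard_le_ncard ?_
    rintro ⟨⟨i, x⟩, ⟨j, y⟩⟩ ⟨h1, h2, h3⟩
    obtain rfl : i = true := h1
    obtain rfl : j = false := by simpa using h2
    rcases (hadj _ _).1 h3 with h | ⟨h, h'⟩
    · exact absurd h.1 (by simp)
    · obtain rfl : x = none := h
      obtain rfl : y = none := (Prod.mk.inj h').2
      rfl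
  have hne : ({p | p.1 = true} : Set (Bool × Option V)).Nonempty := ⟨(true, none), rfl⟩
  have hne' : ({p | p.1 = true}ᶜ : Set (Bool × Option V)).Nonempty := ⟨(false, none), by simp⟩
  have hcard : Fintype.card (Bool × Option V) = 2 * Fintype.card V + 2 := by
    simp; ring
  rw [← hcard]
  refine exists_isPrisonCandidate_of_finite (G := G) ?_ (le_antisymm ?_ hgirth) ?_ ?_
  · rintro ⟨i, _ | x⟩
    · rw [hD _ rfl, ncard_neighborSet_copies, ncard_neighborSet_subdivide_none huv]
    · rw [hD' _ (by simp), ncard_neighborSet_copies, ncard_neighborSet_subdivide_some huv, hC]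
  -- A cycle of `C - u` avoids the subdivided edge `uv`, so it survives.
  · refine (egirth_le_of_hom_injective (G := C.induce {u}ᶜ)
      (fun x ↦ (false, some x.1)) ?_ ?_).trans hu
    · intro x y hxy
      simpa [Subtype.ext_iff] using hxy
    · rintro ⟨x, hx⟩ ⟨y, hy⟩ hxy
      refine (hadj _ _).2 (Or.inl ⟨rfl, hxy, fun h ↦ ?_⟩)
      rcases Sym2.eq_iff.1 h with h | h
      · exact hx h.1
      · exact hy h.2
  · rw [hasEdgeConnectivity_iff]
    refine ⟨fun S hS hS' ↦ ?_, _, hne, hne', hbridge⟩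
    rw [Nat.one_le_iff_ne_zero, ← Nat.pos_iff_ne_zero, Set.ncard_pos]
    by_contra hempty
    rw [Set.not_nonempty_iff_eq_empty] at hempty
    have hclosed : ∀ p q, G.Adj p q → p ∈ S → q ∈ S := by
      intro p q hpq hp
      by_contra hq
      have : (p, q) ∈ adjPairs G S Sᶜ := ⟨hp, hq, hpq⟩
      rw [hempty] at this
      exact this
    have hiff : ∀ p q, G.Adj p q → (p ∈ S ↔ q ∈ S) := fun p q h ↦
      ⟨hclosed p q h, hclosed q p h.symm⟩
    have hend : ∀ i x, x = u ∨ x = v → (((i, some x) : Bool × Option V) ∈ S ↔ (i, none) ∈ S) :=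
      fun i x hx ↦ hiff _ _ ((hadj _ _).2 (Or.inl ⟨rfl, hx⟩))
    -- The subdivided edge persists as a path through `none`, so a set with empty cut cannot
    -- separate vertices adjacent in `C`.
    have hCiff : ∀ i x y, C.Adj x y →
        (((i, some x) : Bool × Option V) ∈ S ↔ (i, some y) ∈ S) := by
      intro i x y hxy
      by_cases he : s(x, y) = s(u, v)
      · rcases Sym2.eq_iff.1 he with ⟨hx, hy⟩ | ⟨hx, hy⟩
        · rw [hend i x (Or.inl hx), hend i y (Or.inr hy)]
        · rw [hend i x (Or.inr hx), hend i y (Or.inl hy)]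
      · exact hiff _ _ ((hadj _ _).2 (Or.inl ⟨rfl, hxy, he⟩))
    have hall : ∀ i x, (((i, some x) : Bool × Option V) ∈ S ↔ (i, none) ∈ S) := by
      intro i x
      rw [← hend i u (Or.inl rfl)]
      by_contra hx
      let T : Set V := {y | ((i, some y) : Bool × Option V) ∈ S ↔ (i, some u) ∈ S}
      have h3 := hcut T ⟨u, Iff.rfl⟩ ⟨x, hx⟩
      obtain ⟨⟨a, b⟩, ha, hb, hab⟩ := (Set.ncard_pos).1 (lt_of_lt_of_le (by norm_num) h3)
      exact hb ((hCiff i a b hab).symm.trans ha)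
    have hnone : (((false, none) : Bool × Option V) ∈ S ↔ (true, none) ∈ S) :=
      hiff _ _ ((hadj _ _).2 (Or.inr ⟨rfl, rfl⟩))
    have htriv : ∀ p : Bool × Option V, p ∈ S ↔ (true, none) ∈ S := by
      rintro ⟨_ | _, _ | x⟩
      · exact hnone
      · exact (hall _ _).trans hnone
      · exact Iff.rfl
      · exact hall _ _
    obtain ⟨p, hp⟩ := hS
    obtain ⟨q, hq⟩ := hS'
    exact hq ((htriv q).2 ((htriv p).1 hp))
  · intro hH
    obtain ⟨F, hF, -, hFcut⟩ := hH.exists_two_regular (by rw [hcard]; omega)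
    have h1 := (hFcut _ hne hne').1
    have h2 := Set.ncard_le_ncard (adjPairs_mono hF {p | p.1 = true} {p | p.1 = true}ᶜ)
      (Set.toFinite _)
    omega

end Bridged

/-! ### Edge-connectivity two: three copies between two hubs -/

section Theta

variable {V : Type} {C : SimpleGraph V} {u v : V} {g : ℕ}

/-- Three copies of `C` without the edge `uv`; one new vertex is joined to the three copies of `u`,
another one to the three copies of `v`. -/
def tripleJoin (C : SimpleGraph V) (u v : V) : SimpleGraph ((Fin 3 × V) ⊕ Bool) where
  Adj
    | .inl p, .inl q => p.1 = q.1 ∧ C.Adj p.2 q.2 ∧ s(p.2, q.2) ≠ s(u, v)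
    | .inl p, .inr b => p.2 = if b then u else v
    | .inr b, .inl q => q.2 = if b then u else v
    | .inr _, .inr _ => False
  symm := ⟨by
    rintro (p | b) (q | c) h
    · exact ⟨h.1.symm, h.2.1.symm, by rw [Sym2.eq_swap]; exact h.2.2⟩
    · exact h
    · exact h
    · exact h⟩
  loopless := ⟨by
    rintro (p | b) h
    · exact h.2.1.ne rfl
    · exact h⟩

theorem ncard_neighborSet_tripleJoin_inl (huv : C.Adj u v) (i : Fin 3) (x : V) :
    ((tripleJoin C u v).neighborSet (.inl (i, x))).ncard = (C.neighborSet x).ncard := by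
  classical
  refine (Set.ncard_congr (t := (tripleJoin C u v).neighborSet (.inl (i, x)))
    (fun y _ ↦ if s(x, y) = s(u, v) then .inr (decide (x = u)) else .inl (i, y)) ?_ ?_ ?_).symm
  · intro y hy
    split_ifs with h
    · change x = if decide (x = u) then u else v
      rcases Sym2.eq_iff.1 h with h | h
      · simp [h.1]
      · simp [h.1, huv.ne']
    · exact ⟨rfl, hy, h⟩
  · intro y y' hy hy' h
    split_ifs at h with h1 h2 h2
    · exact Sym2.congr_right.1 (h1.trans h2.symm)
    · exact (Prod.mk.inj (Sum.inl_injective h)).2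
  · rintro (⟨j, y⟩ | b) hy
    · obtain rfl : i = j := hy.1
      exact ⟨y, hy.2.1, if_neg hy.2.2⟩
    · cases b
      · obtain rfl : x = v := hy
        exact ⟨u, huv.symm, by simp [huv.ne']⟩
      · obtain rfl : x = u := hy
        exact ⟨v, huv, by simp⟩

theorem ncard_neighborSet_tripleJoin_inr (b : Bool) :
    ((tripleJoin C u v).neighborSet (.inr b)).ncard = 3 := by
  have : (tripleJoin C u v).neighborSet (.inr b) =
      (fun i : Fin 3 ↦ Sum.inl (i, if b then u else v)) '' Set.univ := by
    ext (⟨i, x⟩ | c)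
    · simp only [mem_neighborSet, Set.image_univ, Set.mem_range, Sum.inl.injEq, Prod.mk.injEq,
        exists_eq_left]
      exact eq_comm
    · simp only [mem_neighborSet, Set.image_univ, Set.mem_range, reduceCtorEq, exists_false,
        iff_false]
      exact fun h ↦ h
  rw [this, Set.ncard_image_of_injective _ fun i j h ↦ (Prod.mk.inj (Sum.inl_injective h)).1]
  simp

/-- For an edge at a hub, the potential is the truncated distance from its end in its copy of `C -
uv`, and `g - 1` elsewhere. For an edge inside a copy, the potential of that copy extends to the
hubs by its values at `u` and `v`. These differ by at most one, so the other copies need only these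
two values. -/
theorem le_egirth_tripleJoin (hg : 3 ≤ g) (hgC : (g : ℕ∞) ≤ C.egirth) (huv : C.Adj u v) :
    (g : ℕ∞) ≤ (tripleJoin C u v).egirth := by
  classical
  have key : ∀ i b, ∃ f : (Fin 3 × V) ⊕ Bool → ℤ, (∀ x y, (tripleJoin C u v).Adj x y →
      s(x, y) ≠ s(.inl (i, if b then u else v), .inr b) → f y ≤ f x + 1) ∧
      f (.inl (i, if b then u else v)) + g ≤ f (.inr b) + 1 := by
    intro i b
    obtain ⟨d, hd, h0, h1, h2, ht⟩ : ∃ d : V → ℤ,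
        (∀ x y, C.Adj x y → s(x, y) ≠ s(u, v) → d y ≤ d x + 1) ∧ d (if b then u else v) = 0 ∧
        (∀ x, 0 ≤ d x) ∧ (∀ x, d x ≤ (g - 1 : ℕ)) ∧ d (if b then v else u) = (g - 1 : ℕ) := by
      cases b
      · obtain ⟨d, hd, h⟩ := exists_separating_of_adj hgC huv.symm
        exact ⟨d, fun x y h h' ↦ hd x y h (by rwa [Sym2.eq_swap (a := v)]), h⟩
      · exact exists_separating_of_adj hgC huv
    refine ⟨Sum.elim (fun p ↦ if p.1 = i then d p.2 else (g - 1 : ℕ)) fun _ ↦ (g - 1 : ℕ),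
      ?_, ?_⟩
    · have hend : ∀ j c, (j, c) ≠ (i, b) →
          (if j = i then d (if c then u else v) else (g - 1 : ℕ)) = (g - 1 : ℕ) := by
        intro j c hne
        by_cases hj : j = i
        · subst hj
          rw [if_pos rfl]
          cases b <;> cases c <;> first | exact absurd rfl hne | exact ht
        · rw [if_neg hj]
      rintro (⟨j, x⟩ | c) (⟨k, y⟩ | c') h hne
      · obtain rfl : j = k := h.1
        by_cases hj : j = i
        · simpa [hj] using hd x y h.2.1 h.2.2
        · simp [hj]
      · obtain rfl : x = if c' then u else v := h
        have := hend j c' fun h ↦ hne (by rw [(Prod.mk.inj h).1, (Prod.mk.inj h).2])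
        simp only [Sum.elim_inl, Sum.elim_inr]
        omega
      · obtain rfl : y = if c then u else v := h
        have := hend k c fun h ↦
          hne (by rw [(Prod.mk.inj h).1, (Prod.mk.inj h).2]; exact Sym2.eq_swap)
        simp only [Sum.elim_inl, Sum.elim_inr]
        omega
      · exact h.elim
    · simp only [Sum.elim_inl, Sum.elim_inr, if_true, h0]
      omega
  refine le_egirth_of_separating (H := ⊥) (by simp) ?_
  rintro (⟨i, s⟩ | b) (⟨j, t⟩ | c) hst -
  · obtain ⟨hij, hst, hne⟩ := hst
    obtain rfl : i = j := hij
    obtain ⟨d, hd, h0, -, -, ht⟩ := exists_separating_of_adj hgC (s := s) (t := t) hst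
    have huv1 := hd u v huv (Ne.symm hne)
    have huv2 := hd v u huv.symm (by rw [Sym2.eq_swap]; exact Ne.symm hne)
    refine ⟨Sum.elim (fun p ↦ if p.1 = i then d p.2 else if p.2 = v then d v else d u)
      fun b ↦ d (if b then u else v), ?_, Or.inl (by simp [h0, ht]; omega)⟩
    rintro (⟨j, x⟩ | c) (⟨k, y⟩ | c') h hne'
    · obtain rfl : j = k := h.1
      by_cases hj : j = i
      · subst hj
        simp only [Sum.elim_inl, if_true]
        refine hd x y h.2.1 fun he ↦ hne' ?_
        rcases Sym2.eq_iff.1 he with ⟨rfl, rfl⟩ | ⟨rfl, rfl⟩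
        · rfl
        · exact Sym2.eq_swap
      · simp only [Sum.elim_inl, if_neg hj]
        split_ifs <;> omega
    · obtain rfl : x = if c' then u else v := h
      simp only [Sum.elim_inl, Sum.elim_inr]
      cases c' <;> simp [huv.ne]
    · obtain rfl : y = if c then u else v := h
      simp only [Sum.elim_inl, Sum.elim_inr]
      cases c <;> simp [huv.ne]
    · exact h.elim
  · obtain ⟨f, h1, h2⟩ := key i c
    obtain rfl : s = if c then u else v := hst
    exact ⟨f, h1, Or.inl h2⟩
  · obtain ⟨f, h1, h2⟩ := key j b
    obtain rfl : t = if b then u else v := hst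
    exact ⟨f, by rwa [Sym2.eq_swap], Or.inr h2⟩
  · exact hst.elim

/-- If a copy is split, it contributes the at least three cut edges of `C`, less possibly `uv`.
Otherwise each copy lies on one side: when the hubs are together, a copy opposite them gives two
edges; when they are apart, every copy gives one. -/
theorem two_le_ncard_cut_tripleJoin [Finite V]
    (hcut : ∀ S : Set V, S.Nonempty → Sᶜ.Nonempty → 3 ≤ (adjPairs C S Sᶜ).ncard)
    {S : Set ((Fin 3 × V) ⊕ Bool)} (hS : S.Nonempty) (hS' : Sᶜ.Nonempty) :
    2 ≤ (adjPairs (tripleJoin C u v) S Sᶜ).ncard := by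
  classical
  wlog hx : Sum.inr true ∈ S generalizing S
  · rw [ncard_adjPairs_comm]
    have := this hS' (by rwa [compl_compl]) hx
    rwa [compl_compl] at this
  by_cases hsplit : ∃ i a b, Sum.inl (i, a) ∈ S ∧ Sum.inl (i, b) ∉ S
  · obtain ⟨i, a, b, ha, hb⟩ := hsplit
    let T : Set V := {x | Sum.inl (i, x) ∈ S}
    have h3 := hcut T ⟨a, ha⟩ ⟨b, hb⟩
    have hone : {p ∈ adjPairs C T Tᶜ | s(p.1, p.2) = s(u, v)}.ncard ≤ 1 := by
      rw [Set.ncard_le_one (Set.toFinite _)]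
      rintro ⟨x, y⟩ ⟨⟨hx, hy, -⟩, h⟩ ⟨x', y'⟩ ⟨⟨hx', hy', -⟩, h'⟩
      rcases Sym2.eq_iff.1 (h.trans h'.symm) with h | h
      · exact Prod.ext h.1 h.2
      · exact absurd (h.1 ▸ hx) hy'
    have hdiff := Set.le_ncard_sdiff {p ∈ adjPairs C T Tᶜ | s(p.1, p.2) = s(u, v)}
      (adjPairs C T Tᶜ) (Set.toFinite _)
    have hle : (adjPairs C T Tᶜ \ {p ∈ adjPairs C T Tᶜ | s(p.1, p.2) = s(u, v)}).ncard ≤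
        (adjPairs (tripleJoin C u v) S Sᶜ).ncard := by
      refine Set.ncard_le_ncard_of_injOn (fun p ↦ (Sum.inl (i, p.1), Sum.inl (i, p.2))) ?_ ?_
        (Set.toFinite _)
      · rintro ⟨x, y⟩ ⟨⟨hx, hy, hxy⟩, hne⟩
        exact ⟨hx, hy, rfl, hxy, fun h ↦ hne ⟨⟨hx, hy, hxy⟩, h⟩⟩
      · rintro ⟨x, y⟩ _ ⟨x', y'⟩ _ h
        simpa using h
    omega
  · push Not at hsplit
    have hadj : ∀ i b, (tripleJoin C u v).Adj (.inr b) (.inl (i, if b then u else v)) :=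
      fun i b ↦ rfl
    by_cases hy : Sum.inr false ∈ S
    · obtain ⟨i, x, hix⟩ : ∃ i x, Sum.inl (i, x) ∉ S := by
        obtain ⟨⟨i, x⟩ | (_ | _), h⟩ := hS'
        · exact ⟨i, x, h⟩
        · exact absurd hy h
        · exact absurd hx h
      have hout : ∀ y, Sum.inl (i, y) ∉ S := fun y hy ↦ hix (hsplit i y x hy)
      exact (Set.one_lt_ncard_iff (Set.toFinite _)).2 ⟨(.inr true, .inl (i, u)),
        (.inr false, .inl (i, v)), ⟨hx, hout u, hadj i true⟩, ⟨hy, hout v, hadj i false⟩, by simp⟩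
    · have hpair : ∀ i : Fin 3, ∃ p ∈ adjPairs (tripleJoin C u v) S Sᶜ,
          p = (.inr true, .inl (i, u)) ∨ p = (.inl (i, v), .inr false) := by
        intro i
        by_cases hi : Sum.inl (i, u) ∈ S
        · exact ⟨(.inl (i, v), .inr false), ⟨hsplit i u v hi, hy, (hadj i false).symm⟩, Or.inr rfl⟩
        · exact ⟨(.inr true, .inl (i, u)), ⟨hx, hi, hadj i true⟩, Or.inl rfl⟩
      obtain ⟨p, hp, hp'⟩ := hpair 0
      obtain ⟨q, hq, hq'⟩ := hpair 1
      refine (Set.one_lt_ncard_iff (Set.toFinite _)).2 ⟨p, q, hp, hq, ?_⟩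
      rcases hp' with rfl | rfl <;> rcases hq' with rfl | rfl <;> simp

/-- Only two edges leave each copy, and a Hamiltonian cycle would need both. It would then use all
three edges at a hub. -/
theorem exists_isPrisonCandidate_two [Fintype V] [DecidableEq V] (hC : IsCubic C) (hg : 3 ≤ g)
    (hgC : C.egirth = g) (hcut : ∀ S : Set V, S.Nonempty → Sᶜ.Nonempty →
      3 ≤ (adjPairs C S Sᶜ).ncard) (hu : (C.induce {u}ᶜ).egirth ≤ g) :
    ∃ G : SimpleGraph (Fin (3 * Fintype.card V + 2)), IsPrisonCandidate 3 g 2 G := by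
  obtain ⟨v, _, _, _, _, _, hN⟩ := hC.exists_neighbours u
  have huv : C.Adj u v := (hN v).2 (Or.inl rfl)
  let T : Fin 3 → Set ((Fin 3 × V) ⊕ Bool) := fun i ↦ {p | ∃ x, p = .inl (i, x)}
  have hT : ∀ i, (T i).Nonempty := fun i ↦ ⟨.inl (i, u), u, rfl⟩
  have hT' : ∀ i, (T i)ᶜ.Nonempty := fun i ↦ ⟨.inr true, by rintro ⟨x, h⟩; simp at h⟩
  have hTcut : ∀ i, adjPairs (tripleJoin C u v) (T i) (T i)ᶜ ⊆
      {(.inl (i, u), .inr true), (.inl (i, v), .inr false)} := by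
    rintro i ⟨_, q⟩ ⟨⟨x, rfl⟩, hq, h⟩
    rcases q with ⟨j, y⟩ | (_ | _)
    · exact absurd ⟨y, by rw [show i = j from h.1]⟩ hq
    · obtain rfl : x = v := h
      simp
    · obtain rfl : x = u := h
      simp
  have hcard : Fintype.card ((Fin 3 × V) ⊕ Bool) = 3 * Fintype.card V + 2 := by
    simp
  rw [← hcard]
  refine exists_isPrisonCandidate_of_finite (G := tripleJoin C u v) ?_
    (le_antisymm ?_ (le_egirth_tripleJoin hg hgC.ge huv)) ?_ ?_
  · rintro (⟨i, x⟩ | b)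
    · rw [ncard_neighborSet_tripleJoin_inl huv, hC]
    · exact ncard_neighborSet_tripleJoin_inr b
  · refine (egirth_le_of_hom_injective (G := C.induce {u}ᶜ)
      (fun x ↦ .inl (0, x.1)) ?_ ?_).trans hu
    · intro x y hxy
      simpa [Subtype.ext_iff] using hxy
    · rintro ⟨x, hx⟩ ⟨y, hy⟩ hxy
      refine ⟨rfl, hxy, fun h ↦ ?_⟩
      rcases Sym2.eq_iff.1 h with h | h
      · exact hx h.1
      · exact hy h.2
  · rw [hasEdgeConnectivity_iff]
    refine ⟨fun S hS hS' ↦ two_le_ncard_cut_tripleJoin hcut hS hS', T 0, hT 0, hT' 0, ?_⟩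
    exact (Set.ncard_le_ncard (hTcut 0) (Set.toFinite _)).trans (Set.ncard_pair (by simp)).le
  · intro hH
    obtain ⟨F, hF, hF2, hFcut⟩ := hH.exists_two_regular (by rw [hcard]; omega)
    have hall : ∀ i, F.Adj (.inl (i, u)) (.inr true) := by
      intro i
      have h1 := (hFcut _ (hT i) (hT' i)).1
      have heq := Set.eq_of_subset_of_ncard_le
        ((adjPairs_mono hF (T i) (T i)ᶜ).trans (hTcut i))
        ((Set.ncard_pair (by simp)).le.trans h1) (Set.toFinite _)
      have : ((.inl (i, u), .inr true) : ((Fin 3 × V) ⊕ Bool) × ((Fin 3 × V) ⊕ Bool)) ∈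
          adjPairs F (T i) (T i)ᶜ := by rw [heq]; simp
      exact this.2.2
    have hsub : (fun i : Fin 3 ↦ (Sum.inl (i, u) : (Fin 3 × V) ⊕ Bool)) '' Set.univ ⊆
        F.neighborSet (.inr true) := by
      rintro _ ⟨i, -, rfl⟩
      exact (hall i).symm
    have := Set.ncard_le_ncard hsub (Set.toFinite _)
    rw [hF2, Set.ncard_image_of_injective _
      fun i j h ↦ (Prod.mk.inj (Sum.inl_injective h)).1] at this
    simp at this

end Theta

/-! ### Cuts and 2-factors of the Petersen graph -/

section Petersen

/-- The neighbours of a vertex of the Petersen graph: `0, …, 4` is the outer cycle, `5, …, 9` the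
inner pentagram, and the third neighbour is along a spoke. -/
def petersenNbr : Fin 10 → Fin 3 → Fin 10 :=
  ![![1, 4, 5], ![2, 0, 6], ![3, 1, 7], ![4, 2, 8], ![0, 3, 9],
    ![7, 8, 0], ![8, 9, 1], ![9, 5, 2], ![5, 6, 3], ![6, 7, 4]]

/-- The index of a vertex among the neighbours of its `k`-th neighbour. -/
def petersenBack : Fin 3 → Fin 3 := ![1, 0, 2]

theorem petersenNbr_back : ∀ i k, petersenNbr (petersenNbr i k) (petersenBack k) = i := by
  decide

theorem petersenBack_back : ∀ k, petersenBack (petersenBack k) = k := by decide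

theorem petersenNbr_ne : ∀ i k, petersenNbr i k ≠ i := by decide

theorem petersenNbr_injective : ∀ i, Function.Injective (petersenNbr i) := by decide

/-- The Petersen graph. -/
def petersen : SimpleGraph (Fin 10) where
  Adj i j := ∃ k, petersenNbr i k = j
  symm := ⟨by rintro i _ ⟨k, rfl⟩; exact ⟨_, petersenNbr_back i k⟩⟩
  loopless := ⟨by rintro i ⟨k, h⟩; exact petersenNbr_ne i k h⟩

theorem isCubic_petersen : IsCubic petersen := by
  intro i
  have : petersen.neighborSet i = petersenNbr i '' Set.univ := by
    rw [Set.image_univ]; rfl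
  rw [this, Set.ncard_image_of_injective _ (petersenNbr_injective i)]
  simp

theorem five_cycle_bool_cut : ∀ a b c d e : Bool, (b = a ∧ c = a ∧ d = a ∧ e = a) ∨
    2 ≤ (a && !b).toNat + (b && !a).toNat + (b && !c).toNat + (c && !b).toNat +
      (c && !d).toNat + (d && !c).toNat + (d && !e).toNat + (e && !d).toNat +
      (e && !a).toNat + (a && !e).toNat := by
  decide

theorem bool_eq_or_cut : ∀ a b : Bool, b = a ∨ 1 ≤ (a && !b).toNat + (b && !a).toNat := by
  decide

/-- The outer 5-cycle and the inner pentagram, read in its cyclic order `5, 7, 9, 6, 8`, each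
contribute at least two cut edges if split. If only one is split, a spoke supplies the third edge;
if neither is, the cut is trivial or consists of all five spokes. -/
theorem petersen_bool_cut : ∀ b₀ b₁ b₂ b₃ b₄ b₅ b₆ b₇ b₈ b₉ : Bool,
    (b₀ && b₁ && b₂ && b₃ && b₄ && b₅ && b₆ && b₇ && b₈ && b₉) = true ∨
    (b₀ || b₁ || b₂ || b₃ || b₄ || b₅ || b₆ || b₇ || b₈ || b₉) = false ∨ 3 ≤
      (b₀ && !b₁).toNat + (b₀ && !b₄).toNat + (b₀ && !b₅).toNat +
      (b₁ && !b₂).toNat + (b₁ && !b₀).toNat + (b₁ && !b₆).toNat +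
      (b₂ && !b₃).toNat + (b₂ && !b₁).toNat + (b₂ && !b₇).toNat +
      (b₃ && !b₄).toNat + (b₃ && !b₂).toNat + (b₃ && !b₈).toNat +
      (b₄ && !b₀).toNat + (b₄ && !b₃).toNat + (b₄ && !b₉).toNat +
      (b₅ && !b₇).toNat + (b₅ && !b₈).toNat + (b₅ && !b₀).toNat +
      (b₆ && !b₈).toNat + (b₆ && !b₉).toNat + (b₆ && !b₁).toNat +
      (b₇ && !b₉).toNat + (b₇ && !b₅).toNat + (b₇ && !b₂).toNat +
      (b₈ && !b₅).toNat + (b₈ && !b₆).toNat + (b₈ && !b₃).toNat +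
      (b₉ && !b₆).toNat + (b₉ && !b₇).toNat + (b₉ && !b₄).toNat := by
  intro b₀ b₁ b₂ b₃ b₄ b₅ b₆ b₇ b₈ b₉
  rcases five_cycle_bool_cut b₀ b₁ b₂ b₃ b₄ with ⟨rfl, rfl, rfl, rfl⟩ | h <;>
    rcases five_cycle_bool_cut b₅ b₇ b₉ b₆ b₈ with ⟨rfl, rfl, rfl, rfl⟩ | h'
  · rcases bool_eq_or_cut b₄ b₈ with rfl | h
    · cases b₈ <;> simp
    · omega
  · rcases bool_eq_or_cut b₄ b₅ with rfl | h5
    · rcases bool_eq_or_cut b₅ b₆ with rfl | h6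
      · rcases bool_eq_or_cut b₆ b₇ with rfl | h7
        · rcases bool_eq_or_cut b₇ b₈ with rfl | h8
          · rcases bool_eq_or_cut b₈ b₉ with rfl | h9
            · simp at h'
            · omega
          · omega
        · omega
      · omega
    · omega
  · rcases bool_eq_or_cut b₈ b₀ with rfl | h5
    · rcases bool_eq_or_cut b₀ b₁ with rfl | h6
      · rcases bool_eq_or_cut b₁ b₂ with rfl | h7
        · rcases bool_eq_or_cut b₂ b₃ with rfl | h8
          · rcases bool_eq_or_cut b₃ b₄ with rfl | h9
            · simp at h
            · omega
          · omega
        · omega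
      · omega
    · omega
  · omega

theorem three_le_ncard_cut_petersen {S : Set (Fin 10)} (hS : S.Nonempty) (hS' : Sᶜ.Nonempty) :
    3 ≤ (adjPairs petersen S Sᶜ).ncard := by
  classical
  let T : Fin 10 → Bool := fun i ↦ decide (i ∈ S)
  rcases petersen_bool_cut (T 0) (T 1) (T 2) (T 3) (T 4) (T 5) (T 6) (T 7) (T 8) (T 9)
    with h | h | h
  · obtain ⟨b, hb⟩ := hS'
    have : ∀ i, T i = true := by simpa [Fin.forall_fin_succ, and_assoc] using h
    exact absurd (of_decide_eq_true (this b)) hb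
  · obtain ⟨a, ha⟩ := hS
    have : ∀ i, T i = false := by simpa [Fin.forall_fin_succ, and_assoc] using h
    exact absurd ha (of_decide_eq_false (this a))
  · have hsum : 3 ≤ ∑ i, ∑ k, (T i && !T (petersenNbr i k)).toNat := by
      simpa [Fin.sum_univ_succ, petersenNbr, add_assoc] using h
    have hite : ∀ b : Bool, b.toNat = if b then 1 else 0 := by decide
    simp only [hite] at hsum
    rw [← Fintype.sum_prod_type', Finset.sum_boole] at hsum
    refine le_trans hsum ?_
    rw [Nat.cast_id, ← Set.ncard_coe_finset]
    refine Set.ncard_le_ncard_of_injOn (fun q ↦ (q.1, petersenNbr q.1 q.2)) ?_ ?_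
      (Set.toFinite _)
    · rintro ⟨i, k⟩ hq
      have : i ∈ S ∧ petersenNbr i k ∉ S := by simpa [T] using hq
      exact ⟨this.1, this.2, k, rfl⟩
    · rintro ⟨i, k⟩ _ ⟨j, l⟩ _ h
      obtain ⟨h1, h2⟩ := Prod.mk.inj h
      obtain rfl : i = j := h1
      exact Prod.ext rfl (petersenNbr_injective i h2)

/-- This eliminates the spokes: with exactly two of three edges used, the spoke is determined by the
two cycle edges. -/
theorem two_of_three_bool : ∀ a b c : Bool, a.toNat + b.toNat + c.toNat = 2 →
    c = !(a && b) ∧ (a || b) = true := by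
  decide

/-- A perfect matching of the Petersen graph consists of the spokes, or of one spoke, two outer and
two inner edges; `o` and `n` are the outer and the inner edges outside the matching. -/
theorem petersen_two_factor_bool : ∀ o₀ o₄ : Bool, (o₀ || o₄) = true →
    ∀ o₁, (o₁ || o₀) = true → ∀ o₂, (o₂ || o₁) = true → ∀ o₃, (o₃ || o₂) = true →
    (o₄ || o₃) = true → ∀ n₀ n₃, (n₀ && n₃) = (o₀ && o₄) → ∀ n₁ n₄, (n₁ && n₄) = (o₁ && o₀) →
    ∀ n₂, (n₂ && n₀) = (o₂ && o₁) → (n₃ && n₁) = (o₃ && o₂) → (n₄ && n₂) = (o₄ && o₃) →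
    (n₀ || n₃) = true → (n₁ || n₄) = true → (n₂ || n₀) = true → (n₃ || n₁) = true →
    (n₄ || n₂) = true →
    (o₀ && o₁ && o₂ && o₃ && o₄) = true ∨
    (o₀ && o₄ && !o₁ && !o₃ && !n₁ && !n₂) = true ∨
    (o₁ && o₀ && !o₂ && !o₄ && !n₂ && !n₃) = true ∨
    (o₂ && o₁ && !o₃ && !o₀ && !n₃ && !n₄) = true ∨
    (o₃ && o₂ && !o₄ && !o₁ && !n₄ && !n₀) = true ∨
    (o₄ && o₃ && !o₀ && !o₂ && !n₀ && !n₁) = true := by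
  simp only [Bool.forall_bool]
  simp

/-- The Petersen graph has no connected `2`-factor. -/
theorem petersen_no_connected_two_factor (h : Fin 10 → Fin 3 → Bool)
    (hsymm : ∀ i k, h (petersenNbr i k) (petersenBack k) = h i k)
    (htwo : ∀ i, (h i 0).toNat + (h i 1).toNat + (h i 2).toNat = 2)
    (hconn : ∀ T : Finset (Fin 10), T.Nonempty → Tᶜ.Nonempty →
      ∃ i k, i ∈ T ∧ petersenNbr i k ∉ T ∧ h i k = true) : False := by
  have e0 : h 1 1 = h 0 0 := hsymm 0 0
  have e1 : h 2 1 = h 1 0 := hsymm 1 0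
  have e2 : h 3 1 = h 2 0 := hsymm 2 0
  have e3 : h 4 1 = h 3 0 := hsymm 3 0
  have e4 : h 0 1 = h 4 0 := hsymm 4 0
  have e5 : h 7 1 = h 5 0 := hsymm 5 0
  have e6 : h 8 1 = h 6 0 := hsymm 6 0
  have e7 : h 9 1 = h 7 0 := hsymm 7 0
  have e8 : h 5 1 = h 8 0 := hsymm 8 0
  have e9 : h 6 1 = h 9 0 := hsymm 9 0
  have f0 : h 5 2 = h 0 2 := hsymm 0 2
  have f1 : h 6 2 = h 1 2 := hsymm 1 2
  have f2 : h 7 2 = h 2 2 := hsymm 2 2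
  have f3 : h 8 2 = h 3 2 := hsymm 3 2
  have f4 : h 9 2 = h 4 2 := hsymm 4 2
  have t0 := htwo 0
  have t1 := htwo 1
  have t2 := htwo 2
  have t3 := htwo 3
  have t4 := htwo 4
  have t5 := htwo 5
  have t6 := htwo 6
  have t7 := htwo 7
  have t8 := htwo 8
  have t9 := htwo 9
  rw [e4] at t0
  rw [e0] at t1
  rw [e1] at t2
  rw [e2] at t3
  rw [e3] at t4
  rw [e8, f0] at t5
  rw [e9, f1] at t6
  rw [e5, f2] at t7
  rw [e6, f3] at t8
  rw [e7, f4] at t9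
  obtain ⟨s0, t0⟩ := two_of_three_bool _ _ _ t0
  obtain ⟨s1, t1⟩ := two_of_three_bool _ _ _ t1
  obtain ⟨s2, t2⟩ := two_of_three_bool _ _ _ t2
  obtain ⟨s3, t3⟩ := two_of_three_bool _ _ _ t3
  obtain ⟨s4, t4⟩ := two_of_three_bool _ _ _ t4
  obtain ⟨s5, t5⟩ := two_of_three_bool _ _ _ t5
  obtain ⟨s6, t6⟩ := two_of_three_bool _ _ _ t6
  obtain ⟨s7, t7⟩ := two_of_three_bool _ _ _ t7
  obtain ⟨s8, t8⟩ := two_of_three_bool _ _ _ t8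
  obtain ⟨s9, t9⟩ := two_of_three_bool _ _ _ t9
  -- The two ends of a spoke give two expressions for it; equating them relates outer and inner
  -- edges.
  rw [s0, Bool.not_inj_iff] at s5
  rw [s1, Bool.not_inj_iff] at s6
  rw [s2, Bool.not_inj_iff] at s7
  rw [s3, Bool.not_inj_iff] at s8
  rw [s4, Bool.not_inj_iff] at s9
  have := petersen_two_factor_bool _ _ t0 _ t1 _ t2 _ t3 t4 _ _ s5.symm _ _ s6.symm _ s7.symm
    s8.symm s9.symm t5 t6 t7 t8 t9
  simp only [Bool.and_eq_true, Bool.not_eq_true', and_assoc] at this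
  have key : ∀ T : Finset (Fin 10), T.Nonempty → Tᶜ.Nonempty →
      (∀ i ∈ T, ∀ k, petersenNbr i k ∉ T → h i k = false) → False := by
    intro T hT hT' hall
    obtain ⟨i, k, h1, h2, h3⟩ := hconn T hT hT'
    rw [hall i h1 k h2] at h3
    exact absurd h3 (by simp)
  rcases this with h' | h' | h' | h' | h' | h'
  -- In each of the six cases the set spans a 5-cycle of the Petersen graph which no edge of the
  -- 2-factor leaves.
  · refine key {0, 1, 2, 3, 4} (by decide) (by decide) ?_
    simp [Fin.forall_fin_succ, petersenNbr, *]
  · refine key {0, 1, 4, 6, 9} (by decide) (by decide) ?_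
    simp [Fin.forall_fin_succ, petersenNbr, *]
  · refine key {1, 2, 0, 7, 5} (by decide) (by decide) ?_
    simp [Fin.forall_fin_succ, petersenNbr, *]
  · refine key {2, 3, 1, 8, 6} (by decide) (by decide) ?_
    simp [Fin.forall_fin_succ, petersenNbr, *]
  · refine key {3, 4, 2, 9, 7} (by decide) (by decide) ?_
    simp [Fin.forall_fin_succ, petersenNbr, *]
  · refine key {4, 0, 3, 5, 8} (by decide) (by decide) ?_
    simp [Fin.forall_fin_succ, petersenNbr, *]

end Petersen

/-! ### Edge-connectivity three: inflating the Petersen graph -/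

section Inflation

variable {V : Type} {C : SimpleGraph V} {z : V} {g : ℕ}

theorem ncard_neighborSet_induce_compl_singleton [Finite V] (x : ({z}ᶜ : Set V)) :
    (C.Adj z x → ((C.induce {z}ᶜ).neighborSet x).ncard + 1 = (C.neighborSet x).ncard) ∧
    (¬ C.Adj z x → ((C.induce {z}ᶜ).neighborSet x).ncard = (C.neighborSet x).ncard) := by
  have h : ((C.induce {z}ᶜ).neighborSet x).ncard = (C.neighborSet x.1 \ {z}).ncard := by
    refine Set.ncard_congr (fun y _ ↦ y.1) (fun y hy ↦ ⟨hy, y.2⟩)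
      (fun y y' _ _ h ↦ Subtype.ext h) fun y hy ↦ ⟨⟨y, hy.2⟩, hy.1, rfl⟩
  refine ⟨fun hz ↦ ?_, fun hz ↦ ?_⟩
  · rw [h, Set.ncard_sdiff_singleton_add_one (s := C.neighborSet x.1) hz.symm (Set.toFinite _)]
  · rw [h, Set.sdiff_singleton_eq_self (s := C.neighborSet x.1) fun h' ↦ hz (C.adj_symm h')]

/-- Adjacency in the graph obtained from the Petersen graph by replacing every vertex by a copy of
`C` without `z`, whose former neighbours `a k` of `z` take over the edges. -/
def IsInflation (a : Fin 3 → ({z}ᶜ : Set V)) (C : SimpleGraph V)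
    (G : SimpleGraph (Fin 10 × ({z}ᶜ : Set V))) : Prop :=
  ∀ i x j y, G.Adj (i, x) (j, y) ↔
    (i = j ∧ C.Adj x y) ∨ ∃ k, x = a k ∧ j = petersenNbr i k ∧ y = a (petersenBack k)

/-- For an edge between copies, the potential in the copy of one end is the distance from that end
in `C - z`, truncated at `g - 2`, and is `g - 1` elsewhere. The other two former neighbours of `z`
in that copy have value `g - 2`, so the remaining connecting edges change by at most one. -/
theorem exists_isInflation [Finite V] (hC : IsCubic C) (hg : 3 ≤ g) (hgC : (g : ℕ∞) ≤ C.egirth)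
    (a : Fin 3 → ({z}ᶜ : Set V)) (ha : Function.Injective a)
    (haz : ∀ x : ({z}ᶜ : Set V), C.Adj z x ↔ ∃ k, x = a k) :
    ∃ G, IsInflation a C G ∧ IsCubic G ∧ (g : ℕ∞) ≤ G.egirth := by
  classical
  let idx : ({z}ᶜ : Set V) → Fin 3 := Function.invFun a
  have hidx : ∀ k, idx (a k) = k := Function.leftInverse_invFun ha
  let τ : Fin 10 × ({z}ᶜ : Set V) → Fin 10 × ({z}ᶜ : Set V) :=
    fun p ↦ (petersenNbr p.1 (idx p.2), a (petersenBack (idx p.2)))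
  have hτ1 : ∀ p, (τ p).1 ≠ p.1 := fun p ↦ petersenNbr_ne _ _
  obtain ⟨hadj, hgirth, hD, hD'⟩ := addMatching_spec (H := copies (Fin 10) (C.induce {z}ᶜ))
    (D := {p | C.Adj z p.2}) (τ := τ) hg
    (le_egirth_copies (by omega) (hgC.trans
      (egirth_le_of_hom_injective _ Subtype.val_injective fun _ _ h ↦ h))) (by
      rintro ⟨i, x⟩ hx
      obtain ⟨k, rfl⟩ := (haz x).1 hx
      refine ⟨(haz _).2 ⟨_, rfl⟩, ?_⟩
      simp only [τ, hidx, petersenNbr_back, petersenBack_back]) (by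
      rintro ⟨i, x⟩ hx
      obtain ⟨d, h0, h1, h2, h3, h4⟩ := exists_truncated_dist (restrictTo C {z}ᶜ) x.1 (g - 2)
      have hd : ∀ y : ({z}ᶜ : Set V), C.Adj z y → y ≠ x → d y = (g - 2 : ℕ) := fun y hy hyx ↦
        le_antisymm (h2 y) (h4 y _ le_rfl fun p ↦ by
          have := le_length_add_two_of_restrictTo hgC (by simp) x.2 hx hy
            (fun h ↦ hyx (Subtype.ext h.symm)) p
          omega)
      refine ⟨fun p ↦ if p.1 = i then d p.2 else g - 1, ?_, ?_, Or.inl ?_⟩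
      · rintro ⟨j, y⟩ ⟨k, w⟩ ⟨hjk, hyw⟩
        obtain rfl : j = k := hjk
        by_cases hj : j = i
        · simpa [hj] using h3 y w ⟨y.2, w.2, hyw⟩
        · simp [hj]
      · rintro ⟨j, y⟩ hy hne hne'
        have hle := h2 (τ (j, y)).2
        by_cases hj : j = i
        · subst hj
          have := hd y hy fun h ↦ hne (by rw [h])
          have h' : (τ (j, y)).1 ≠ j := hτ1 (j, y)
          simp only [h', if_true, if_false, this]
          omega
        · simp only [hj, if_false]
          split_ifs <;> omega
      · have h' : (τ (i, x)).1 ≠ i := hτ1 (i, x)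
        simp only [h', if_true, if_false, h0]
        omega)
  refine ⟨_, ?_, ?_, hgirth⟩
  · intro i x j y
    rw [hadj]
    refine or_congr Iff.rfl ⟨?_, ?_⟩
    · rintro ⟨hx, h⟩
      obtain ⟨k, rfl⟩ := (haz x).1 hx
      obtain ⟨h1, h2⟩ := Prod.mk.inj h
      simp only [hidx] at h1 h2
      exact ⟨k, rfl, h1, h2⟩
    · rintro ⟨k, rfl, rfl, rfl⟩
      refine ⟨(haz _).2 ⟨_, rfl⟩, ?_⟩
      simp only [τ, hidx]
  · rintro ⟨i, x⟩
    by_cases hx : C.Adj z x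
    · rw [hD _ hx, ncard_neighborSet_copies, (ncard_neighborSet_induce_compl_singleton x).1 hx, hC]
    · rw [hD' _ hx, ncard_neighborSet_copies, (ncard_neighborSet_induce_compl_singleton x).2 hx, hC]

/-- In a `3`-edge-connected cubic graph, deleting a vertex leaves a `2`-edge-connected graph. -/
theorem two_le_ncard_adjPairs_of_partition {V : Type*} [Finite V] {G : SimpleGraph V} {z : V}
    (hz : (G.neighborSet z).ncard = 3)
    (hcut : ∀ S : Set V, S.Nonempty → Sᶜ.Nonempty → 3 ≤ (adjPairs G S Sᶜ).ncard) {A B : Set V}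
    (hA : A.Nonempty) (hB : B.Nonempty) (hAB : Disjoint A B) (hu : A ∪ B = {z}ᶜ) :
    2 ≤ (adjPairs G A B).ncard := by
  have hzA : z ∉ A := fun h ↦ (hu.subset (Or.inl h)) rfl
  have hzB : z ∉ B := fun h ↦ (hu.subset (Or.inr h)) rfl
  have hAc : Aᶜ = B ∪ {z} := by
    ext x
    have := Set.ext_iff.1 hu x
    have h' : x ∈ A → x ∉ B := fun h h' ↦ Set.disjoint_left.1 hAB h h'
    simp only [Set.mem_union, Set.mem_compl_iff, Set.mem_singleton_iff] at this ⊢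
    by_cases hx : x = z
    · subst hx; tauto
    · tauto
  have hBc : Bᶜ = A ∪ {z} := by
    ext x
    have := Set.ext_iff.1 hu x
    have h' : x ∈ A → x ∉ B := fun h h' ↦ Set.disjoint_left.1 hAB h h'
    simp only [Set.mem_union, Set.mem_compl_iff, Set.mem_singleton_iff] at this ⊢
    by_cases hx : x = z
    · subst hx; tauto
    · tauto
  have h1 := hcut A hA ⟨z, hzA⟩
  have h2 := hcut B hB ⟨z, hzB⟩
  rw [hAc, ncard_adjPairs_union_right (by simpa using hzB)] at h1
  rw [hBc, ncard_adjPairs_union_right (by simpa using hzA), ncard_adjPairs_comm B A] at h2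
  have h3 := ncard_adjPairs_singleton_compl (G := G) z
  rw [← hu, ncard_adjPairs_union_right hAB, hz, ncard_adjPairs_comm _ A,
    ncard_adjPairs_comm _ B] at h3
  omega

variable {a : Fin 3 → ({z}ᶜ : Set V)} {G : SimpleGraph (Fin 10 × ({z}ᶜ : Set V))}

/-- Contracting everything outside copy `i` to `z` recovers `C`, so the cut edges of `C` inject into
those of `G`. -/
theorem IsInflation.three_le_ncard_cut_of_subset [Finite V] (hG : IsInflation a C G)
    (haz : ∀ x : ({z}ᶜ : Set V), C.Adj z x ↔ ∃ k, x = a k)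
    (hcut : ∀ S : Set V, S.Nonempty → Sᶜ.Nonempty → 3 ≤ (adjPairs C S Sᶜ).ncard)
    {S : Set (Fin 10 × ({z}ᶜ : Set V))} (hS : S.Nonempty) {i : Fin 10} (hi : ∀ p ∈ S, p.1 = i) :
    3 ≤ (adjPairs G S Sᶜ).ncard := by
  classical
  let A : Set V := {x | ∃ h : x ∈ ({z}ᶜ : Set V), (i, ⟨x, h⟩) ∈ S}
  have h3 := hcut A (by
    obtain ⟨⟨j, x⟩, hx⟩ := hS
    obtain rfl : j = i := hi _ hx
    exact ⟨x, x.2, hx⟩) ⟨z, fun h ↦ h.1 rfl⟩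
  refine h3.trans ?_
  have hex : ∀ p ∈ adjPairs C A Aᶜ, ∃ q ∈ adjPairs G S Sᶜ, q.1.2 = p.1 ∧
      ((p.2 = z ∧ q.2.1 ≠ i) ∨ (q.2.2 = p.2 ∧ q.2.1 = i)) := by
    rintro ⟨x, y⟩ ⟨⟨hxz, hx⟩, hy, hxy⟩
    by_cases hyz : y = z
    · subst hyz
      obtain ⟨k, hk⟩ := (haz ⟨x, hxz⟩).1 hxy.symm
      refine ⟨((i, ⟨x, hxz⟩), (petersenNbr i k, a (petersenBack k))), ⟨hx, fun h ↦ ?_, ?_⟩,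
        rfl, Or.inl ⟨rfl, petersenNbr_ne i k⟩⟩
      · exact petersenNbr_ne i k (hi _ h)
      · exact (hG _ _ _ _).2 (Or.inr ⟨k, hk, rfl, rfl⟩)
    · exact ⟨((i, ⟨x, hxz⟩), (i, ⟨y, hyz⟩)), ⟨hx, fun h ↦ hy ⟨hyz, h⟩,
        (hG _ _ _ _).2 (Or.inl ⟨rfl, hxy⟩)⟩, rfl, Or.inr ⟨rfl, rfl⟩⟩
  have : Nonempty ({z}ᶜ : Set V) := ⟨a 0⟩
  choose! f hf1 hf2 hf3 using hex
  refine Set.ncard_le_ncard_of_injOn f hf1 ?_ (Set.toFinite _)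
  rintro p hp q hq hpq
  have e1 := hf2 p hp
  have e2 := hf2 q hq
  have e3 := hf3 p hp
  have e4 := hf3 q hq
  rw [hpq] at e1 e3
  refine Prod.ext (e1.symm.trans e2) ?_
  rcases e3 with e3 | e3 <;> rcases e4 with e4 | e4
  · exact e3.1.trans e4.1.symm
  · exact absurd e4.2 e3.2
  · exact absurd e3.2 e4.2
  · exact e3.1.symm.trans e4.1

theorem IsInflation.two_le_ncard_of_split [Finite V] (hG : IsInflation a C G) (hC : IsCubic C)
    (hcut : ∀ S : Set V, S.Nonempty → Sᶜ.Nonempty → 3 ≤ (adjPairs C S Sᶜ).ncard)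
    {S : Set (Fin 10 × ({z}ᶜ : Set V))} {i : Fin 10} {x y : ({z}ᶜ : Set V)} (hx : (i, x) ∈ S)
    (hy : (i, y) ∉ S) : 2 ≤ {p ∈ adjPairs G S Sᶜ | p.1.1 = i ∧ p.2.1 = i}.ncard := by
  let A : Set V := {x | ∃ h : x ∈ ({z}ᶜ : Set V), (i, ⟨x, h⟩) ∈ S}
  let B : Set V := {x | ∃ h : x ∈ ({z}ᶜ : Set V), (i, ⟨x, h⟩) ∉ S}
  have h2 := two_le_ncard_adjPairs_of_partition (z := z) (hC z) hcut (A := A) (B := B)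
    ⟨x, x.2, hx⟩ ⟨y, y.2, hy⟩
    (Set.disjoint_left.2 fun w hw hw' ↦ hw'.2 hw.2) (by
      ext w
      constructor
      · rintro (h | h)
        · exact h.1
        · exact h.1
      · intro hw
        by_cases h : (i, ⟨w, hw⟩) ∈ S
        · exact Or.inl ⟨hw, h⟩
        · exact Or.inr ⟨hw, h⟩)
  refine h2.trans ?_
  have hex : ∀ p ∈ adjPairs C A B, ∃ q ∈ {p ∈ adjPairs G S Sᶜ | p.1.1 = i ∧ p.2.1 = i},
      q.1.2 = p.1 ∧ q.2.2 = p.2 := by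
    rintro ⟨x, y⟩ ⟨⟨hxz, hx⟩, ⟨hyz, hy⟩, hxy⟩
    exact ⟨((i, ⟨x, hxz⟩), (i, ⟨y, hyz⟩)), ⟨⟨hx, hy, (hG _ _ _ _).2 (Or.inl ⟨rfl, hxy⟩)⟩,
      rfl, rfl⟩, rfl, rfl⟩
  have : Nonempty ({z}ᶜ : Set V) := ⟨a 0⟩
  choose! f hf1 hf2 hf3 using hex
  refine Set.ncard_le_ncard_of_injOn f hf1 ?_ (Set.toFinite _)
  rintro p hp q hq hpq
  have e1 := hf2 p hp
  have e3 := hf3 p hp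
  rw [hpq] at e1 e3
  exact Prod.ext (e1.symm.trans (hf2 q hq)) (e3.symm.trans (hf3 q hq))

theorem IsInflation.ncard_adjPairs_petersen_le [Finite V] (hG : IsInflation a C G)
    {S : Set (Fin 10 × ({z}ᶜ : Set V))} {T T' : Set (Fin 10)} (hT : ∀ i ∈ T, ∀ x, (i, x) ∈ S)
    (hT' : ∀ i ∈ T', ∀ x, (i, x) ∉ S) :
    (adjPairs petersen T T').ncard ≤ {p ∈ adjPairs G S Sᶜ | p.1.1 ≠ p.2.1 ∧ p.1.1 ∈ T ∧
      p.2.1 ∈ T'}.ncard := by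
  have hex : ∀ p ∈ adjPairs petersen T T', ∃ q ∈ {p ∈ adjPairs G S Sᶜ | p.1.1 ≠ p.2.1 ∧
      p.1.1 ∈ T ∧ p.2.1 ∈ T'}, q.1.1 = p.1 ∧ q.2.1 = p.2 := by
    rintro ⟨i, j⟩ ⟨hi, hj, k, hk⟩
    obtain rfl : petersenNbr i k = j := hk
    exact ⟨((i, a k), (petersenNbr i k, a (petersenBack k))), ⟨⟨hT i hi _, hT' _ hj _,
      (hG _ _ _ _).2 (Or.inr ⟨k, rfl, rfl, rfl⟩)⟩, (petersenNbr_ne i k).symm, hi, hj⟩, rfl, rfl⟩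
  have : Nonempty ({z}ᶜ : Set V) := ⟨a 0⟩
  choose! f hf1 hf2 hf3 using hex
  refine Set.ncard_le_ncard_of_injOn f hf1 ?_ (Set.toFinite _)
  rintro p hp q hq hpq
  have e1 := hf2 p hp
  have e3 := hf3 p hp
  rw [hpq] at e1 e3
  exact Prod.ext (e1.symm.trans (hf2 q hq)) (e3.symm.trans (hf3 q hq))

/-- Each split copy contributes two inner edges, which settles two or more split copies. With one
split copy, the Petersen graph minus a vertex gives two more edges, unless `S` or its complement
lies in that copy. With none, the cut comes from the Petersen graph. -/
theorem IsInflation.three_le_ncard_cut [Finite V] (hG : IsInflation a C G) (hC : IsCubic C)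
    (haz : ∀ x : ({z}ᶜ : Set V), C.Adj z x ↔ ∃ k, x = a k)
    (hcut : ∀ S : Set V, S.Nonempty → Sᶜ.Nonempty → 3 ≤ (adjPairs C S Sᶜ).ncard)
    {S : Set (Fin 10 × ({z}ᶜ : Set V))} (hS : S.Nonempty) (hS' : Sᶜ.Nonempty) :
    3 ≤ (adjPairs G S Sᶜ).ncard := by
  have hfin : (adjPairs G S Sᶜ).Finite := Set.toFinite _
  by_cases hsplit : ∃ i x y, (i, x) ∈ S ∧ (i, y) ∉ S
  · obtain ⟨i, x, y, hx, hy⟩ := hsplit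
    have h2 := hG.two_le_ncard_of_split hC hcut hx hy
    by_cases hsplit' : ∃ j x y, j ≠ i ∧ (j, x) ∈ S ∧ (j, y) ∉ S
    · obtain ⟨j, x', y', hji, hx', hy'⟩ := hsplit'
      have h2' := hG.two_le_ncard_of_split hC hcut hx' hy'
      have hle := Set.ncard_le_ncard (s := {p ∈ adjPairs G S Sᶜ | p.1.1 = i ∧ p.2.1 = i} ∪
        {p ∈ adjPairs G S Sᶜ | p.1.1 = j ∧ p.2.1 = j})
        (Set.union_subset (fun _ h ↦ h.1) (fun _ h ↦ h.1)) hfin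
      rw [Set.ncard_union_eq (Set.disjoint_left.2 fun p hp hp' ↦
        hji (hp'.2.1.symm.trans hp.2.1)) (Set.toFinite _) (Set.toFinite _)] at hle
      omega
    · push Not at hsplit'
      let T : Set (Fin 10) := {j | j ≠ i ∧ (j, a 0) ∈ S}
      let T' : Set (Fin 10) := {j | j ≠ i ∧ (j, a 0) ∉ S}
      have hT : ∀ j ∈ T, ∀ w, (j, w) ∈ S := fun j hj w ↦ hsplit' j _ w hj.1 hj.2
      have hT' : ∀ j ∈ T', ∀ w, (j, w) ∉ S := fun j hj w hw ↦ hj.2 (hsplit' j w _ hj.1 hw)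
      rcases T.eq_empty_or_nonempty with hTe | hTn
      · refine hG.three_le_ncard_cut_of_subset haz hcut hS (i := i) ?_
        rintro ⟨j, w⟩ hw
        by_contra hji
        have : j ∈ T := ⟨hji, hsplit' j w _ hji hw⟩
        rw [hTe] at this
        exact this
      rcases T'.eq_empty_or_nonempty with hTe' | hTn'
      · rw [ncard_adjPairs_comm]
        have := hG.three_le_ncard_cut_of_subset haz hcut hS' (i := i) (by
          rintro ⟨j, w⟩ hw
          by_contra hji
          have : j ∈ T' := ⟨hji, fun h ↦ hw (hsplit' j _ w hji h)⟩
          rw [hTe'] at this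
          exact this)
        rwa [compl_compl] at this
      have h3 := two_le_ncard_adjPairs_of_partition (z := i) (isCubic_petersen i)
        (fun _ h h' ↦ three_le_ncard_cut_petersen h h') hTn hTn'
        (Set.disjoint_left.2 fun j hj hj' ↦ hj'.2 hj.2) (by
          ext j
          simp only [T, T', Set.mem_union, Set.mem_ofPred_eq, Set.mem_compl_iff,
            Set.mem_singleton_iff]
          tauto)
      have h4 := hG.ncard_adjPairs_petersen_le hT hT'
      have hle := Set.ncard_le_ncard (s := {p ∈ adjPairs G S Sᶜ | p.1.1 = i ∧ p.2.1 = i} ∪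
        {p ∈ adjPairs G S Sᶜ | p.1.1 ≠ p.2.1 ∧ p.1.1 ∈ T ∧ p.2.1 ∈ T'})
        (Set.union_subset (fun _ h ↦ h.1) (fun _ h ↦ h.1)) hfin
      rw [Set.ncard_union_eq (Set.disjoint_left.2 fun p hp hp' ↦
        hp'.2.1 (hp.2.1.trans hp.2.2.symm)) (Set.toFinite _) (Set.toFinite _)] at hle
      omega
  · push Not at hsplit
    let T : Set (Fin 10) := {j | (j, a 0) ∈ S}
    have h3 := three_le_ncard_cut_petersen (S := T)
      (by obtain ⟨⟨j, w⟩, hw⟩ := hS; exact ⟨j, hsplit j w _ hw⟩)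
      (by obtain ⟨⟨j, w⟩, hw⟩ := hS'; exact ⟨j, fun h ↦ hw (hsplit j _ w h)⟩)
    have h4 := hG.ncard_adjPairs_petersen_le (S := S) (T := T) (T' := Tᶜ)
      (fun j hj w ↦ hsplit j _ w hj) (fun j hj w hw ↦ hj (hsplit j w _ hw))
    exact h3.trans (h4.trans (Set.ncard_le_ncard (fun _ h ↦ h.1) hfin))

/-- Only three edges leave a copy, so a Hamiltonian cycle uses exactly two of them, the only
positive even number available. Contracting the copies gives a connected 2-factor of the Petersen
graph. -/
theorem IsInflation.not_isHamiltonian [Fintype V] [DecidableEq V] (hG : IsInflation a C G)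
    (ha : Function.Injective a) : ¬ G.IsHamiltonian := by
  classical
  intro hH
  obtain ⟨F, hF, -, hFcut⟩ := hH.exists_two_regular (by
    intro h1
    have := Fintype.card_le_one_iff.1 h1.le ((0 : Fin 10), a 0) ((1 : Fin 10), a 0)
    simp at this)
  have hcross : ∀ {i x j y}, F.Adj (i, x) (j, y) → i ≠ j →
      ∃ k, x = a k ∧ j = petersenNbr i k ∧ y = a (petersenBack k) := by
    intro i x j y h hij
    rcases (hG _ _ _ _).1 (hF h) with h | h
    · exact absurd h.1 hij
    · exact h
  let h : Fin 10 → Fin 3 → Bool := fun i k ↦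
    decide (F.Adj (i, a k) (petersenNbr i k, a (petersenBack k)))
  refine petersen_no_connected_two_factor h (fun i k ↦ ?_) (fun i ↦ ?_) (fun T hT hT' ↦ ?_)
  · simp only [h, petersenNbr_back, petersenBack_back, decide_eq_decide]
    exact F.adj_comm _ _
  · let S : Set (Fin 10 × ({z}ᶜ : Set V)) := {p | p.1 = i}
    have hev := hFcut S ⟨(i, a 0), rfl⟩ ⟨(petersenNbr i 0, a 0), petersenNbr_ne i 0⟩
    have hcard : (adjPairs F S Sᶜ).ncard = (Finset.univ.filter fun k ↦ h i k = true).card := by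
      rw [← Set.ncard_coe_finset]
      refine (Set.ncard_congr
        (fun k _ ↦ ((i, a k), (petersenNbr i k, a (petersenBack k)))) ?_ ?_ ?_).symm
      · intro k hk
        have : F.Adj (i, a k) (petersenNbr i k, a (petersenBack k)) := by simpa [h] using hk
        exact ⟨rfl, petersenNbr_ne i k, this⟩
      · intro k l _ _ hkl
        exact ha (Prod.mk.inj (Prod.mk.inj hkl).1).2
      · rintro ⟨⟨j, x⟩, ⟨j', y⟩⟩ ⟨hj, hj', hjj⟩
        obtain rfl : j = i := hj
        obtain ⟨k, rfl, rfl, rfl⟩ := hcross hjj (fun e ↦ hj' e.symm)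
        exact ⟨k, by simpa [h] using hjj, rfl⟩
    rw [hcard, Finset.card_filter, Fin.sum_univ_three] at hev
    have hbool : ∀ b₀ b₁ b₂ : Bool,
        2 ≤ (if b₀ = true then 1 else 0) + (if b₁ = true then 1 else 0) +
          (if b₂ = true then 1 else 0) ∧
        Even ((if b₀ = true then 1 else 0) + (if b₁ = true then 1 else 0) +
          (if b₂ = true then 1 else 0)) → b₀.toNat + b₁.toNat + b₂.toNat = 2 := by
      decide
    exact hbool _ _ _ hev
  · let S : Set (Fin 10 × ({z}ᶜ : Set V)) := {p | p.1 ∈ T}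
    obtain ⟨i, hi⟩ := hT
    obtain ⟨j, hj⟩ := hT'
    have h2 := (hFcut S ⟨(i, a 0), hi⟩ ⟨(j, a 0), Finset.mem_compl.1 hj⟩).1
    obtain ⟨⟨⟨i, x⟩, ⟨j, y⟩⟩, hi, hj, hij⟩ :=
      (Set.ncard_pos (Set.toFinite _)).1 (lt_of_lt_of_le two_pos h2)
    obtain ⟨k, rfl, rfl, rfl⟩ := hcross hij (by rintro rfl; exact hj hi)
    exact ⟨i, k, hi, hj, by simpa [h] using hij⟩

theorem exists_isPrisonCandidate_three [Fintype V] [DecidableEq V] (hC : IsCubic C) (hg : 3 ≤ g)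
    (hgC : C.egirth = g) (hcut : ∀ S : Set V, S.Nonempty → Sᶜ.Nonempty →
      3 ≤ (adjPairs C S Sᶜ).ncard) (hz : (C.induce {z}ᶜ).egirth ≤ g) :
    ∃ G : SimpleGraph (Fin (10 * (Fintype.card V - 1))), IsPrisonCandidate 3 g 3 G := by
  obtain ⟨p, q, r, hpq, hpr, hqr, hN⟩ := hC.exists_neighbours z
  have hp : p ∈ ({z}ᶜ : Set V) := ((hN p).2 (by simp)).ne'
  have hq : q ∈ ({z}ᶜ : Set V) := ((hN q).2 (by simp)).ne'
  have hr : r ∈ ({z}ᶜ : Set V) := ((hN r).2 (by simp)).ne'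
  let a : Fin 3 → ({z}ᶜ : Set V) := ![⟨p, hp⟩, ⟨q, hq⟩, ⟨r, hr⟩]
  have ha : Function.Injective a := by
    intro i j hij
    fin_cases i <;> fin_cases j <;> simp_all [a]
  have haz : ∀ x : ({z}ᶜ : Set V), C.Adj z x ↔ ∃ k, x = a k := by
    rintro ⟨x, hx⟩
    simp [hN, Fin.exists_fin_succ, a]
  obtain ⟨G, hG, hG3, hGg⟩ := exists_isInflation hC hg hgC.ge a ha haz
  have hcard : Fintype.card (Fin 10 × ({z}ᶜ : Set V)) = 10 * (Fintype.card V - 1) := by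
    rw [Fintype.card_prod, Fintype.card_fin, Fintype.card_compl_set]
    simp
  rw [← hcard]
  refine exists_isPrisonCandidate_of_finite hG3 (le_antisymm ?_ hGg) ?_ (hG.not_isHamiltonian ha)
  · refine (egirth_le_of_hom_injective (G := C.induce {z}ᶜ) (fun x ↦ ((0 : Fin 10), x))
      (fun x y h ↦ (Prod.mk.inj h).2) fun x y hxy ↦ ?_).trans hz
    exact (hG _ _ _ _).2 (Or.inl ⟨rfl, hxy⟩)
  · rw [hasEdgeConnectivity_iff]
    refine ⟨fun S hS hS' ↦ hG.three_le_ncard_cut hC haz hcut hS hS', {(0, a 0)}, ⟨_, rfl⟩,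
      ⟨(1, a 0), by simp⟩, ?_⟩
    rw [ncard_adjPairs_singleton_compl, hG3]

end Inflation

/-! ### Minimal graphs, cages, prisons and the final bounds -/

theorem exists_iso_fin (V : Type) [Finite V] (G : SimpleGraph V) :
    ∃ G' : SimpleGraph (Fin (Nat.card V)), Nonempty (G ≃g G') :=
  ⟨_, ⟨Iso.map (Finite.equivFin V) G⟩⟩

/-- Nonemptiness is imposed because the empty graph is vacuously cubic and has infinite girth. -/
theorem exists_isMinimalCubic (g : ℕ) :
    ∃ (n : ℕ) (_ : Nonempty (Fin n)) (C : SimpleGraph (Fin n)), IsMinimalCubic g C := by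
  classical
  have hex : ∃ n, 0 < n ∧ ∃ G : SimpleGraph (Fin n), IsCubic G ∧ (g : ℕ∞) ≤ G.egirth := by
    obtain ⟨V, _, _, G, h1, h2⟩ := exists_isCubic_le_egirth g
    obtain ⟨G', ⟨φ⟩⟩ := exists_iso_fin V G
    exact ⟨Nat.card V, Nat.card_pos, G', h1.of_iso φ, by rwa [← φ.egirth_eq]⟩
  obtain ⟨hpos, C, h1, h2⟩ := Nat.find_spec hex
  refine ⟨Nat.find hex, ⟨⟨0, hpos⟩⟩, C, h1, h2, fun U _ _ G h3 h4 ↦ ?_⟩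
  rw [Nat.card_eq_fintype_card, Fintype.card_fin]
  obtain ⟨G', ⟨φ⟩⟩ := exists_iso_fin U G
  exact Nat.find_min' hex ⟨Nat.card_pos, G', h3.of_iso φ, by rwa [← φ.egirth_eq]⟩

theorem IsMinimalCubic.isCage {g n : ℕ} [Nonempty (Fin n)] {C : SimpleGraph (Fin n)} (hg : 3 ≤ g)
    (h : IsMinimalCubic g C) : IsCage 3 g C := by
  refine ⟨⟨(isRegularOfDegree_three_iff _).2 h.isCubic, h.egirth_eq hg⟩, fun m H hH ↦ ?_⟩
  -- Finite girth provides a cycle, hence a vertex, so the empty graph is excluded from the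
  -- comparison.
  have hac : ¬ H.IsAcyclic := fun hac ↦ by
    have := hH.2
    rw [hac.egirth_eq_top] at this
    exact ENat.natCast_ne_top g this.symm
  obtain ⟨a, -⟩ := exists_egirth_eq_length.2 hac
  have : Nonempty (Fin m) := ⟨a⟩
  have := h.card_le (Fin m) H ((isRegularOfDegree_three_iff _).1 hH.1) hH.2.ge
  simpa using this

theorem cageOrder_eq_of_isCage {k g n : ℕ} {C : SimpleGraph (Fin n)} (h : IsCage k g C) :
    cageOrder k g = n := by
  refine le_antisymm (Nat.sInf_le ⟨C, h⟩) ?_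
  obtain ⟨G, hG⟩ := Nat.sInf_mem (s := {n | ∃ G : SimpleGraph (Fin n), IsCage k g G}) ⟨n, C, h⟩
  exact h.2 _ G hG.1

theorem exists_isPrison_of_candidate {k g e N : ℕ} {G : SimpleGraph (Fin N)}
    (h : IsPrisonCandidate k g e G) :
    (∃ G : SimpleGraph (Fin (prisonOrder k g e)), IsPrison k g e G) ∧ prisonOrder k g e ≤ N := by
  classical
  have hex : ∃ n, ∃ G : SimpleGraph (Fin n), IsPrisonCandidate k g e G := ⟨N, G, h⟩
  obtain ⟨P, hP⟩ := Nat.find_spec hex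
  have hprison : IsPrison k g e P := ⟨hP, fun m H hH ↦ Nat.find_min' hex ⟨H, hH⟩⟩
  have hle : prisonOrder k g e ≤ Nat.find hex := Nat.sInf_le ⟨P, hprison⟩
  exact ⟨Nat.sInf_mem (s := {n | ∃ G : SimpleGraph (Fin n), IsPrison k g e G}) ⟨_, P, hprison⟩,
    hle.trans (Nat.find_min' hex ⟨G, h⟩)⟩

/-- The existence of a cage on `cageOrder 3 g` vertices and of prisons on `prisonOrder 3 g e`
vertices is part of the conclusion, so both numbers are genuine minima. -/
theorem mainTheorem4 (g : ℕ) (hg : 3 ≤ g) :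
    (∀ e : ℕ, (e = 1 ∨ e = 2 ∨ e = 3) →
      ∃ (n : ℕ) (G : SimpleGraph (Fin n)), IsPrisonCandidate 3 g e G) ∧
    (∃ G : SimpleGraph (Fin (cageOrder 3 g)), IsCage 3 g G) ∧
    (∀ e : ℕ, (e = 1 ∨ e = 2 ∨ e = 3) →
      ∃ G : SimpleGraph (Fin (prisonOrder 3 g e)), IsPrison 3 g e G) ∧
    prisonOrder 3 g 1 ≤ 2 * cageOrder 3 g + 2 ∧
    prisonOrder 3 g 2 ≤ 3 * cageOrder 3 g + 2 ∧
    (prisonOrder 3 g 3 : ℤ) ≤ 10 * (cageOrder 3 g : ℤ) - 10 := by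
  obtain ⟨n, hn, C, hC⟩ := exists_isMinimalCubic g
  have hcage := hC.isCage hg
  have hgirth := hC.egirth_eq hg
  obtain ⟨z, hz⟩ := hC.isCubic.exists_egirth_induce_le hg hgirth
  have hcut := fun S hS hS' ↦ hC.three_le_ncard_cut hg (S := S) hS hS'
  obtain ⟨G₁, h₁⟩ := exists_isPrisonCandidate_one hC.isCubic hg hgirth hcut hz
  obtain ⟨G₂, h₂⟩ := exists_isPrisonCandidate_two hC.isCubic hg hgirth hcut hz
  obtain ⟨G₃, h₃⟩ := exists_isPrisonCandidate_three hC.isCubic hg hgirth hcut hz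
  obtain ⟨p₁, l₁⟩ := exists_isPrison_of_candidate h₁
  obtain ⟨p₂, l₂⟩ := exists_isPrison_of_candidate h₂
  obtain ⟨p₃, l₃⟩ := exists_isPrison_of_candidate h₃
  rw [Fintype.card_fin] at l₁ l₂ l₃
  -- Positivity turns the truncated `10 * (n - 1)` into the integer `10 * n - 10`.
  have hpos : 0 < n := z.pos
  rw [cageOrder_eq_of_isCage hcage]
  refine ⟨?_, ⟨C, hcage⟩, ?_, l₁, l₂, by omega⟩
  · rintro e (rfl | rfl | rfl)
    · exact ⟨_, G₁, h₁⟩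
    · exact ⟨_, G₂, h₂⟩
    · exact ⟨_, G₃, h₃⟩
  · rintro e (rfl | rfl | rfl)
    · exact p₁
    · exact p₂
    · exact p₃
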